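/- Let $G$ be a second countable, locally compact (Hausdorff) unimodular group with Haar measure $\mu$, and let $\pi : G \to \mathcal{U}(\mathcal{H})$ be a projective unitary representation on a separable Hilbert space $\mathcal{H}$, i.e. a strongly measurable map with $\pi(x)\pi(y) = \sigma(x,y)\pi(xy)$ for some function $\sigma : G\times G \to \mathbb{T}$. Assume that $\pi$ is a discrete series representation: it is irreducible (the only closed $\pi(G)$-invariant subspaces are $\{0\}$ and $\mathcal{H}$), and $\int_G |\langle g_0, \pi(x) g_0\rangle|^2 \, d\mu(x) < \infty$ for some $g_0 \neq 0$. Let $d_\pi > 0$ be its formal degree, i.e. the unique number with \[ \int_G \langle f_1, \pi(x) g_1\rangle \langle \pi(x) g_2, f_2\rangle \, d\mu(x) = d_\pi^{-1} \langle f_1, f_2\rangle \overline{\langle g_1, g_2\rangle} \quad \text{for all } f_1,f_2,g_1,g_2 \in \mathcal{H}. \] For $g \in \mathcal{H}$ write $V_g g(x) = \langle g, \pi(x) g\rangle$; for a relatively compact symmetric unit neighborhood $Q \subseteq G$ write $M_Q F(x) = \sup_{z \in Q} |F(xz)|$; and let $\mathcal{D}_\pi$ be the set of all $g \in \mathcal{H}$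 with $M_Q V_g g \in L^2(G)$ for one (equivalently, every) such $Q$. A strong Følner exhaustion sequence in $G$ is a sequence $(K_n)_{n\in\mathbb{N}}$ of nonnull compact sets with $\mu(K_n K \cap K_n^c K)/\mu(K_n) \to 0$ for every compact $K \subseteq G$, with $e \in K_n \subseteq (K_{n+1})^\circ$ for all $n$, and with $\bigcup_n K_n = G$. For $\Lambda \subseteq G$, the family $\pi(\Lambda)g = (\pi(\lambda)g)_{\lambda\in\Lambda}$ is a Riesz sequence with Riesz bounds $A, B > 0$ if $A\|c\|^2 \le \big\|\sum_{\lambda\in\Lambda} c_\lambda \pi(\lambda) g\big\|^2 \le B\|c\|^2$ for all $c \in \ell^2(\Lambda)$ (the series being convergent). Theorem. Let $Q \subseteq G$ be a relatively compact symmetric unit neighborhood, let $g \in \mathcal{D}_\pi$, and let $A, B > 0$. There is a constant $C > 0$, depending (for given $G$, $\mu$ and $\pi$) only on $g$, $Q$, $A$ and $B$, such that for every $\Lambda \subseteq G$ for which $\pi(\Lambda) g$ is a Riesz sequence with Riesz bounds $A, B$, and for every strong Følner exhaustion sequence $(K_n)_{n \in \mathbb{N}}$ in $G$, \[ \sup_{x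 \in G} \#(\Lambda \cap xK_n) \le d_\pi\big(\mu(K_n) + C J_n\big) \quad \text{for all } n \in \mathbb{N}, \] where \[ J_n := \int_{K_n^c} \int_{K_n Q} |M_Q V_g g(y^{-1}z)|^2 \, d\mu(z)\, d\mu(y) < \infty \qquad\text{and}\qquad J_n = o(\mu(K_n)) \ \text{ as } n \to \infty. \] -/

import Mathlib

open MeasureTheory Filter Topology Set
open scoped Pointwise ENNReal ComplexConjugate

noncomputable section

namespace CoherentSystem

/-- `Q` is a relatively compact symmetric unit neighborhood. -/
structure IsSymmUnitNhd {G : Type*} [Group G] [TopologicalSpace G] (Q : Set G) : Prop where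
  mem_nhds : Q ∈ 𝓝 (1 : G)
  symm : Q⁻¹ = Q
  relCompact : IsCompact (closure Q)

/-- A (right) strong Følner sequence: nonnull compact sets `K n` with
`μ (K n * L ∩ (K n)ᶜ * L) / μ (K n) → 0` for all compact `L`. -/
structure IsStrongFolner {G : Type*} [Group G] [TopologicalSpace G] [MeasurableSpace G]
    (μ : Measure G) (K : ℕ → Set G) : Prop where
  isCompact : ∀ n, IsCompact (K n)
  nonnull : ∀ n, μ (K n) ≠ 0
  tendsto : ∀ L : Set G, IsCompact L →
    Tendsto (fun n => μ ((K n * L) ∩ ((K n)ᶜ * L)) / μ (K n)) atTop (𝓝 0)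

/-- A strong Følner exhaustion sequence. -/
structure IsStrongFolnerExhaustion {G : Type*} [Group G] [TopologicalSpace G]
    [MeasurableSpace G] (μ : Measure G) (K : ℕ → Set G) : Prop
    extends IsStrongFolner μ K where
  one_mem : ∀ n, (1 : G) ∈ K n
  subset_interior : ∀ n, K n ⊆ interior (K (n + 1))
  iUnion_eq : ⋃ n, K n = univ

/-- A projective unitary representation of `G` on `H`: a strongly measurable map into the unitary
operators, multiplicative up to a circle-valued cocycle. -/
structure ProjRep (G H : Type*) [Group G] [MeasurableSpace G] [NormedAddCommGroup H]
    [InnerProductSpace ℂ H] where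
  toFun : G → H ≃ₗᵢ[ℂ] H
  cocycle : G → G → Circle
  stronglyMeasurable : ∀ f : H, StronglyMeasurable fun x => toFun x f
  mul_apply : ∀ x y f, toFun x (toFun y f) = (cocycle x y : ℂ) • toFun (x * y) f

instance {G H : Type*} [Group G] [MeasurableSpace G] [NormedAddCommGroup H]
    [InnerProductSpace ℂ H] : CoeFun (ProjRep G H) (fun _ => G → H ≃ₗᵢ[ℂ] H) :=
  ⟨ProjRep.toFun⟩

section

variable {G H : Type*} [Group G] [MeasurableSpace G] [NormedAddCommGroup H]
  [InnerProductSpace ℂ H]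

/-- The coefficient transform `V_g f (x) = ⟨f, π(x) g⟩`, where the inner product `⟨·, ·⟩` is linear
in the first argument; Mathlib's `inner ℂ` is linear in the second one. -/
def coeff (π : ProjRep G H) (g f : H) (x : G) : ℂ := inner ℂ (π x g) f

/-- The only closed invariant subspaces are `{0}` and `H`. -/
def IsIrreducible (π : ProjRep G H) : Prop :=
  ∀ W : Submodule ℂ H, IsClosed (W : Set H) → (∀ x, ∀ f ∈ W, π x f ∈ W) → W = ⊥ ∨ W = ⊤

/-- A projective discrete series representation: irreducible and square-integrable. -/
structure IsDiscreteSeries (μ : Measure G) (π : ProjRep G H) : Prop where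
  irreducible : IsIrreducible π
  squareIntegrable : ∃ g : H, g ≠ 0 ∧ ∫⁻ x, ‖coeff π g g x‖ₑ ^ 2 ∂μ < ∞

/-- `d > 0` satisfies the orthogonality relations
`∫ ⟨f₁, π(x) g₁⟩ ⟨π(x) g₂, f₂⟩ dμ(x) = d⁻¹ ⟨f₁, f₂⟩ conj ⟨g₁, g₂⟩`
(inner products linear in the first argument). -/
def IsFormalDegree (μ : Measure G) (π : ProjRep G H) (d : ℝ) : Prop :=
  0 < d ∧ ∀ f₁ f₂ g₁ g₂ : H,
    Integrable (fun x => coeff π g₁ f₁ x * conj (coeff π g₂ f₂ x)) μ ∧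
    ∫ x, coeff π g₁ f₁ x * conj (coeff π g₂ f₂ x) ∂μ
      = (d : ℂ)⁻¹ * inner ℂ f₂ f₁ * conj (inner ℂ g₂ g₁)

open Classical in
/-- The formal degree `d_π`: the number `d > 0` for which the orthogonality relations hold
(`0` if there is none). -/
def formalDegree (μ : Measure G) (π : ProjRep G H) : ℝ :=
  if h : ∃ d, IsFormalDegree μ π d then h.choose else 0

/-- The local maximal function `M_Q F (x) = sup_{z ∈ Q} |F (x z)|`, with values in `[0, ∞]`. -/
def localMax (Q : Set G) (F : G → ℂ) (x : G) : ℝ≥0∞ := ⨆ z ∈ Q, ‖F (x * z)‖ₑ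

/-- The set `D_π` of vectors `g` with `M_U V_g g ∈ L²(G)` for some relatively compact symmetric unit
neighborhood `U`. The condition does not depend on `U`, and `M_U V_g g` is always measurable, being
a supremum of continuous functions. -/
def localized [TopologicalSpace G] (μ : Measure G) (π : ProjRep G H) : Set H :=
  {g | ∃ U : Set G, IsSymmUnitNhd U ∧ ∫⁻ x, localMax U (coeff π g g) x ^ 2 ∂μ < ∞}

/-- The family `(π(t) g)`, `t ∈ Λ`, is a Riesz sequence with Riesz bounds `A, B > 0`. -/
def IsRieszSeq (π : ProjRep G H) (Λ : Set G) (g : H) (A B : ℝ) : Prop :=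
  0 < A ∧ 0 < B ∧ ∀ c : lp (fun _ : Λ => ℂ) 2,
    Summable (fun t : Λ => c t • π (t : G) g) ∧
    A * ‖c‖ ^ 2 ≤ ‖∑' t : Λ, c t • π (t : G) g‖ ^ 2 ∧
    ‖∑' t : Λ, c t • π (t : G) g‖ ^ 2 ≤ B * ‖c‖ ^ 2

/-- `J = ∫_{Kᶜ} ∫_{K Q} |M_Q V_g g (y⁻¹ z)|² dμ(z) dμ(y)`. -/
def rieszError (μ : Measure G) (π : ProjRep G H) (g : H) (Q K : Set G) : ℝ≥0∞ :=
  ∫⁻ y in Kᶜ, ∫⁻ z in K * Q, localMax Q (coeff π g g) (y⁻¹ * z) ^ 2 ∂μ ∂μ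

end

end CoherentSystem

end

open CoherentSystem

/-! The bound is a trace computation. Let `F` be a finite subset of Λ ∩ K and let P be the
orthogonal projection onto V = span π(F)g. The lower Riesz bound gives dim V = #F, and summing the
orthogonality relations over an orthonormal basis of V gives #F · ‖g‖² = d_π ∫ ‖Pπ(y)g‖² dμ(y).

On K the integrand is at most ‖g‖², which produces the main term d_π μ(K). Off K, the lower Riesz
bound passes to a frame inequality on V, so ‖Pπ(y)g‖² ≤ A⁻¹ ∑ |V_g g(y⁻¹t)|², summed over t in `F`
(`IsRieszSeq.card_mul_le`). The upper Riesz bound makes Λ relatively separated, uniformly in Λ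
(`exists_card_filter_le`), so this sum is controlled by the integral of |M_Q V_g g(y⁻¹z)|² over z in
KQ (`measure_mul_sum_enorm_sq_le`). Integrating over y outside K gives J. Both μ(K) and J are
invariant under left translation of K, hence the supremum over x.

For J = o(μ(K_n)), the substitution w = y⁻¹z writes J as an integral of |M_Q V_g g(w)|² against μ(Kᶜ
∩ KQw⁻¹). Divided by μ(K), these weights are eventually bounded and tend to 0 by the Følner
condition, so dominated convergence applies.

The formal degree is a chosen number, so its existence has to be proved: Schur's lemma on the graph
of V_g, the symmetry of f and g under x ↦ x⁻¹, and polarization. -/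

namespace CoherentSystem

/-- A left- and right-invariant Haar measure is inversion invariant. -/
theorem isInvInvariant_of_isMulRightInvariant {G : Type*} [Group G] [TopologicalSpace G]
    [IsTopologicalGroup G] [LocallyCompactSpace G] [SecondCountableTopology G]
    [MeasurableSpace G] [BorelSpace G]
    (μ : Measure G) [μ.IsHaarMeasure] [μ.IsMulRightInvariant] : μ.IsInvInvariant := by
  constructor
  have hfin : IsFiniteMeasureOnCompacts μ.inv :=
    ⟨fun K hK => by rw [Measure.inv_apply]; exact hK.inv.measure_lt_top⟩
  -- Inversion scales μ by a constant c; inverting twice gives c² = 1, so c = 1.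
  let c : ℝ≥0∞ := Measure.haarScalarFactor μ.inv μ
  have hc : μ.inv = c • μ := Measure.isMulLeftInvariant_eq_smul μ.inv μ
  have : Measure.map Inv.inv (Measure.map Inv.inv μ) = c ^ 2 • μ := by
    rw [← Measure.inv_def μ, hc, Measure.map_smul, ← Measure.inv_def μ, hc, smul_smul, pow_two]
  have μeq : μ = c ^ 2 • μ := by
    rw [Measure.map_map continuous_inv.measurable continuous_inv.measurable] at this
    simpa only [inv_involutive, Function.Involutive.comp_self, Measure.map_id]
  have K : TopologicalSpace.PositiveCompacts G := Classical.arbitrary _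
  have : c ^ 2 * μ K = 1 ^ 2 * μ K := by
    conv_rhs => rw [μeq]
    simp
  have : c ^ 2 = 1 ^ 2 :=
    (ENNReal.mul_left_inj (Measure.measure_pos_of_nonempty_interior _ K.interior_nonempty).ne'
          K.isCompact.measure_lt_top.ne).1 this
  have : c = 1 := (ENNReal.pow_right_strictMono two_ne_zero).injective this
  rw [hc, this, one_smul]

/-! ### Matrix coefficients up to phases -/

section Basic

variable {G H : Type*} [Group G] [MeasurableSpace G] [NormedAddCommGroup H]
  [InnerProductSpace ℂ H]

theorem ProjRep.inner_apply_apply (π : ProjRep G H) (x y : G) (a b : H) :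
    inner ℂ (π x a) (π y b) =
      ((π.cocycle x (x⁻¹ * y))⁻¹ : Circle) * inner ℂ a (π (x⁻¹ * y) b) := by
  have h := π.mul_apply x (x⁻¹ * y) b
  rw [mul_inv_cancel_left] at h
  have h2 : π y b = ((π.cocycle x (x⁻¹ * y))⁻¹ : Circle) • π x (π (x⁻¹ * y) b) := by
    rw [h, Circle.smul_def, smul_smul, ← Circle.coe_mul]
    simp
  rw [h2, Circle.smul_def, inner_smul_right, LinearIsometryEquiv.inner_map_map]

theorem ProjRep.norm_inner_apply_apply (π : ProjRep G H) (x y : G) (a b : H) :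
    ‖inner ℂ (π x a) (π y b)‖ = ‖inner ℂ a (π (x⁻¹ * y) b)‖ := by
  rw [π.inner_apply_apply, norm_mul, Circle.norm_coe, one_mul]

theorem ProjRep.one_apply (π : ProjRep G H) (f : H) : π 1 f = π.cocycle 1 1 • f := by
  have h := π.mul_apply 1 1 f
  rw [mul_one, ← map_smul] at h
  exact (π 1).injective h

theorem ProjRep.norm_inner_one_right (π : ProjRep G H) (a b : H) :
    ‖inner ℂ a (π 1 b)‖ = ‖inner ℂ a b‖ := by
  rw [π.one_apply, Circle.smul_def, inner_smul_right, norm_mul, Circle.norm_coe, one_mul]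

theorem norm_coeff_apply (π : ProjRep G H) (g f : H) (y x : G) :
    ‖coeff π g (π y f) x‖ = ‖coeff π g f (y⁻¹ * x)‖ := by
  rw [coeff, coeff, norm_inner_symm, π.norm_inner_apply_apply, norm_inner_symm]

theorem norm_coeff_inv (π : ProjRep G H) (g f : H) (x : G) :
    ‖coeff π g f x‖ = ‖coeff π f g x⁻¹‖ := by
  rw [coeff, coeff, ← π.norm_inner_one_right, π.norm_inner_apply_apply, mul_one, norm_inner_symm]

theorem norm_coeff_one (π : ProjRep G H) (g f : H) : ‖coeff π g f 1‖ = ‖inner ℂ g f‖ := by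
  rw [coeff, norm_inner_symm, π.norm_inner_one_right, norm_inner_symm]

theorem stronglyMeasurable_coeff (π : ProjRep G H) (g f : H) :
    StronglyMeasurable (coeff π g f) :=
  (π.stronglyMeasurable g).inner stronglyMeasurable_const

end Basic

/-! ### Continuity of |V_g f| from measurability of π -/

section Continuity

variable {G H : Type*} [Group G] [TopologicalSpace G] [IsTopologicalGroup G]
    [LocallyCompactSpace G] [SecondCountableTopology G]
    [MeasurableSpace G] [BorelSpace G]
    [NormedAddCommGroup H] [InnerProductSpace ℂ H]
    [TopologicalSpace.SeparableSpace H]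

/-- By the Steinhaus theorem, `π u g` is close to `g` up to a phase for `u` near `1`. -/
theorem exists_phase_nhds (μ : Measure G) [μ.IsHaarMeasure] (π : ProjRep G H) (g : H) {ε : ℝ}
    (hε : 0 < ε) :
    ∃ U ∈ 𝓝 (1 : G), ∀ u ∈ U, ∃ θ : Circle, ‖π u g - θ • g‖ < ε := by
  let E : ℕ → Set G := fun k => {x | ‖π x g - TopologicalSpace.denseSeq H k‖ < ε / 2}
  have hEm : ∀ k, MeasurableSet (E k) := fun k =>
    measurableSet_lt (((π.stronglyMeasurable g).sub stronglyMeasurable_const).norm.measurable)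
      measurable_const
  have hcov : ⋃ k, E k = univ := by
    refine eq_univ_of_forall fun x => mem_iUnion.2 ?_
    obtain ⟨k, hk⟩ := (TopologicalSpace.denseRange_denseSeq H).exists_dist_lt (π x g)
      (half_pos hε)
    exact ⟨k, by simpa [E, dist_eq_norm] using hk⟩
  obtain ⟨k, hk⟩ : ∃ k, μ (E k) ≠ 0 := by
    by_contra! h
    have := measure_iUnion_null h
    rw [hcov] at this
    exact (NeZero.ne μ) (Measure.measure_univ_eq_zero.1 this)
  have hpos : 0 < μ (E k)⁻¹ := by
    rw [pos_iff_ne_zero, Ne, measure_inv_null]; exact hk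
  -- Steinhaus is applied to E⁻¹ so that the neighborhood consists of the products x⁻¹y with x, y in
  -- E; then π(x)π(x⁻¹y) is π(y) up to a phase.
  refine ⟨_, Measure.div_mem_nhds_one_of_haar_pos μ (E k)⁻¹ (hEm k).inv hpos, ?_⟩
  rintro u ⟨a, ha, b, hb, rfl⟩
  set x := a⁻¹ with hx
  set y := b⁻¹ with hy
  have hxE : ‖π x g - TopologicalSpace.denseSeq H k‖ < ε / 2 := ha
  have hyE : ‖π y g - TopologicalSpace.denseSeq H k‖ < ε / 2 := hb
  have hxy : ‖π y g - π x g‖ < ε := by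
    have := norm_sub_le (π y g - TopologicalSpace.denseSeq H k)
      (π x g - TopologicalSpace.denseSeq H k)
    rw [sub_sub_sub_cancel_right] at this
    linarith
  refine ⟨π.cocycle x (a / b), ?_⟩
  have h := π.mul_apply x (a / b) g
  have hxab : x * (a / b) = y := by simp [hx, hy, div_eq_mul_inv]
  rw [hxab] at h
  rw [← (π x).norm_map, map_sub, h, Circle.smul_def, map_smul, ← smul_sub, norm_smul,
    Circle.norm_coe, one_mul]
  exact hxy

/-- The phase in `exists_phase_nhds` is uncontrolled, but it disappears in the modulus. -/
theorem continuous_norm_coeff (μ : Measure G) [μ.IsHaarMeasure] (π : ProjRep G H) (g f : H) :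
    Continuous fun x => ‖coeff π g f x‖ := by
  refine continuous_iff_continuousAt.2 fun x => Metric.tendsto_nhds.2 fun ε hε => ?_
  have hf : 0 < ‖f‖ + 1 := by positivity
  obtain ⟨U, hU, hUε⟩ := exists_phase_nhds μ π g (div_pos hε hf)
  rw [← map_mul_left_nhds_one x, eventually_map]
  filter_upwards [hU] with u hu
  obtain ⟨θ, hθ⟩ := hUε u hu
  have h1 : ‖coeff π g f (x * u)‖ = ‖inner ℂ (π x (π u g)) f‖ := by
    rw [π.mul_apply, inner_smul_left, norm_mul, RCLike.norm_conj, Circle.norm_coe, one_mul, coeff]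
  have h2 : ‖coeff π g f x‖ = ‖inner ℂ (π x (θ • g)) f‖ := by
    rw [Circle.smul_def, map_smul, inner_smul_left, norm_mul, RCLike.norm_conj, Circle.norm_coe,
      one_mul, coeff]
  rw [Real.dist_eq, h1, h2]
  calc _ ≤ ‖inner ℂ (π x (π u g)) f - inner ℂ (π x (θ • g)) f‖ := abs_norm_sub_norm_le _ _
    _ = ‖inner ℂ (π x (π u g - θ • g)) f‖ := by rw [← inner_sub_left, map_sub]
    _ ≤ ‖π u g - θ • g‖ * ‖f‖ := by
      have := norm_inner_le_norm (𝕜 := ℂ) (π x (π u g - θ • g)) f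
      rwa [LinearIsometryEquiv.norm_map] at this
    _ ≤ ‖π u g - θ • g‖ * (‖f‖ + 1) := by gcongr; linarith
    _ < ε / (‖f‖ + 1) * (‖f‖ + 1) := by gcongr
    _ = ε := div_mul_cancel₀ _ hf.ne'

end Continuity

/-! ### Schur's lemma -/

section Schur

variable {G H : Type*} [Group G] [MeasurableSpace G] [NormedAddCommGroup H]
  [InnerProductSpace ℂ H]

/-- An operator commuting with an irreducible representation is zero or injective. -/
theorem IsIrreducible.eq_zero_or_injective {π : ProjRep G H} (hπ : IsIrreducible π)
    (T : H →L[ℂ] H) (hT : ∀ x f, T (π x f) = π x (T f)) : T = 0 ∨ ∀ f, T f = 0 → f = 0 := by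
  rcases hπ T.ker T.isClosed_ker (fun x f hf => by
    simp only [LinearMap.mem_ker, ContinuousLinearMap.coe_coe] at hf ⊢
    rw [hT, hf, map_zero]) with h | h
  · right
    intro f hf
    have : f ∈ T.ker := hf
    rwa [h, Submodule.mem_bot] at this
  · left
    ext f
    have : f ∈ T.ker := h ▸ Submodule.mem_top
    simpa using this

variable [CompleteSpace H]

/-- **Schur's lemma** for self-adjoint operators. -/
theorem IsIrreducible.exists_eq_smul {π : ProjRep G H} (hπ : IsIrreducible π) [Nontrivial H]
    (T : H →L[ℂ] H) (hTs : IsSelfAdjoint T) (hT : ∀ x f, T (π x f) = π x (T f)) :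
    ∃ c : ℝ, ∀ f, T f = (c : ℂ) • f := by
  have hcomm : ∀ φ : ℝ → ℝ, ∀ x f, cfc φ T (π x f) = π x (cfc φ T f) := by
    intro φ x f
    have h : Commute T ((π x).toContinuousLinearEquiv : H →L[ℂ] H) := by
      ext f; exact hT x f
    have := (h.cfc_real φ).eq
    exact DFunLike.congr_fun this f
  obtain ⟨a, ha⟩ : (spectrum ℝ T).Nonempty :=
    ContinuousFunctionalCalculus.spectrum_nonempty T hTs
  -- With two spectral points, tent functions of disjoint supports around them would give nonzero
  -- operators with product 0, both commuting with π; but the first of them is injective.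
  have hsub : ∀ b ∈ spectrum ℝ T, b = a := by
    intro b hb
    by_contra hab
    have hd : 0 < |b - a| := abs_pos.2 (sub_ne_zero.2 hab)
    let φ : ℝ → ℝ := fun t => max 0 (|b - a| / 2 - |t - a|)
    let ψ : ℝ → ℝ := fun t => max 0 (|b - a| / 2 - |t - b|)
    have hφ : Continuous φ := by fun_prop
    have hψ : Continuous ψ := by fun_prop
    have hmul : cfc φ T * cfc ψ T = 0 := by
      rw [← cfc_mul φ ψ T hφ.continuousOn hψ.continuousOn]
      have : (fun t => φ t * ψ t) = fun _ => (0 : ℝ) := by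
        funext t
        rcases le_total (|b - a| / 2) |t - a| with h | h
        · simp [φ, max_eq_left (sub_nonpos.2 h)]
        · have h3 : |b - a| ≤ |t - a| + |t - b| := by
            rw [abs_sub_comm t b, add_comm]; exact abs_sub_le b t a
          have : |b - a| / 2 ≤ |t - b| := by linarith
          simp [ψ, max_eq_left (sub_nonpos.2 this)]
      rw [this]; exact cfc_const_zero ℝ T
    have hne : ∀ (χ : ℝ → ℝ), Continuous χ → ∀ t ∈ spectrum ℝ T, χ t ≠ 0 → cfc χ T ≠ 0 := by
      intro χ hχ t ht h0 hz
      have h1 : χ t ∈ spectrum ℝ (cfc χ T) := by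
        rw [cfc_map_spectrum χ T hTs hχ.continuousOn]
        exact mem_image_of_mem χ ht
      rw [hz, spectrum.zero_eq] at h1
      exact h0 h1
    have hφ0 : cfc φ T ≠ 0 := hne φ hφ a ha (by simp [φ, sub_ne_zero.2 hab])
    have hψ0 : cfc ψ T ≠ 0 := hne ψ hψ b hb (by simp [ψ, sub_ne_zero.2 hab])
    rcases hπ.eq_zero_or_injective _ (hcomm φ) with h | h
    · exact hφ0 h
    · refine hψ0 (ContinuousLinearMap.ext fun f => h _ ?_)
      exact DFunLike.congr_fun hmul f
  refine ⟨a, fun f => ?_⟩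
  have h1 : cfc (fun t : ℝ => t) T = cfc (fun _ : ℝ => a) T := cfc_congr hsub
  rw [cfc_id' ℝ T, cfc_const a T] at h1
  conv_lhs => rw [h1]
  simp [Algebra.algebraMap_eq_smul_one]

/-- A Hilbert space mapping injectively and equivariantly into the space of an irreducible
representation maps onto it, and the map is a multiple of a unitary. -/
theorem IsIrreducible.exists_norm_sq_eq {π : ProjRep G H} (hπ : IsIrreducible π)
    {E : Type*} [NormedAddCommGroup E] [InnerProductSpace ℂ E] [CompleteSpace E] [Nontrivial E]
    (p : E →L[ℂ] H) (hp : ∀ ξ, p ξ = 0 → ξ = 0) (ρ : G → E → E)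
    (hρ : ∀ x ξ, p (ρ x ξ) = π x (p ξ))
    (hρi : ∀ x ξ η, inner ℂ (ρ x ξ) (ρ x η) = inner ℂ ξ η)
    (hρs : ∀ x, Function.Surjective (ρ x)) :
    Function.Surjective p ∧ ∃ c : ℝ, 0 < c ∧ ∀ ξ, ‖ξ‖ ^ 2 = c * ‖p ξ‖ ^ 2 := by
  obtain ⟨ξ₀, hξ₀⟩ := exists_ne (0 : E)
  have hpξ₀ : p ξ₀ ≠ 0 := fun h => hξ₀ (hp _ h)
  have : Nontrivial H := ⟨p ξ₀, 0, hpξ₀⟩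
  have hadj : ∀ x f, p.adjoint (π x f) = ρ x (p.adjoint f) := by
    intro x f
    refine ext_inner_right ℂ fun η => ?_
    obtain ⟨η, rfl⟩ := hρs x η
    rw [ContinuousLinearMap.adjoint_inner_left, hρ, hρi, LinearIsometryEquiv.inner_map_map,
      ContinuousLinearMap.adjoint_inner_left]
  obtain ⟨c, hc⟩ := hπ.exists_eq_smul (p ∘L p.adjoint)
    (by
      rw [ContinuousLinearMap.isSelfAdjoint_iff', ContinuousLinearMap.adjoint_comp,
        ContinuousLinearMap.adjoint_adjoint])
    (fun x f => by simp [hadj, hρ])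
  have hc' : ∀ f, p (p.adjoint f) = (c : ℂ) • f := hc
  -- From pp* = c follows p(p*pξ - cξ) = 0, and p is injective.
  have hpp : ∀ ξ, p.adjoint (p ξ) = (c : ℂ) • ξ := fun ξ =>
    sub_eq_zero.1 (hp _ (by rw [map_sub, hc', map_smul, sub_self]))
  have hnorm : ∀ ξ, ‖p ξ‖ ^ 2 = c * ‖ξ‖ ^ 2 := by
    intro ξ
    have h1 : inner ℂ (p ξ) (p ξ) = (c : ℂ) * inner ℂ ξ ξ := by
      rw [← ContinuousLinearMap.adjoint_inner_left, hpp, inner_smul_left, Complex.conj_ofReal]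
    rw [inner_self_eq_norm_sq_to_K, inner_self_eq_norm_sq_to_K] at h1
    apply Complex.ofReal_injective
    simpa using h1
  have hcpos : 0 < c := by
    have h1 : 0 < c * ‖ξ₀‖ ^ 2 := by rw [← hnorm]; positivity
    exact pos_of_mul_pos_left h1 (by positivity)
  refine ⟨fun f => ⟨(c⁻¹ : ℂ) • p.adjoint f, ?_⟩, c⁻¹, inv_pos.2 hcpos, fun ξ => ?_⟩
  · rw [map_smul, hc', smul_smul, inv_mul_cancel₀ (by exact_mod_cast hcpos.ne'), one_smul]
  · rw [hnorm]; field_simp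

end Schur

/-! ### The graph of V_g and its isometry property -/

section Graph

variable {G H : Type*} [Group G] [MeasurableSpace G] [NormedAddCommGroup H]
  [InnerProductSpace ℂ H]

theorem coeff_add (π : ProjRep G H) (g f h : H) (x : G) :
    coeff π g (f + h) x = coeff π g f x + coeff π g h x := inner_add_right _ _ _

theorem coeff_smul (π : ProjRep G H) (g : H) (a : ℂ) (f : H) (x : G) :
    coeff π g (a • f) x = a * coeff π g f x := inner_smul_right _ _ _

theorem coeff_add_left (π : ProjRep G H) (g h f : H) (x : G) :
    coeff π (g + h) f x = coeff π g f x + coeff π h f x := by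
  simp only [coeff, map_add, inner_add_left]

theorem coeff_smul_left (π : ProjRep G H) (a : ℂ) (g f : H) (x : G) :
    coeff π (a • g) f x = conj a * coeff π g f x := by
  simp only [coeff, map_smul, inner_smul_left]

/-- The phase is the same for all g and f, so it cancels in products of one coefficient with the
conjugate of another. -/
theorem exists_coeff_apply_eq (π : ProjRep G H) (y x : G) :
    ∃ θ : ℂ, ‖θ‖ = 1 ∧ ∀ g f, coeff π g (π y f) x = θ * coeff π g f (y⁻¹ * x) := by
  refine ⟨conj (((π.cocycle y (y⁻¹ * x))⁻¹ : Circle) : ℂ),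
    by rw [RCLike.norm_conj, Circle.norm_coe], fun g f => ?_⟩
  rw [coeff, ← inner_conj_symm, π.inner_apply_apply, map_mul, inner_conj_symm, coeff]

/-- The graph of the coefficient transform `f ↦ V_g f`, as an operator into `L²`. -/
noncomputable def coeffGraph (μ : Measure G) (π : ProjRep G H) (g : H) :
    Submodule ℂ (WithLp 2 (H × Lp ℂ 2 μ)) where
  carrier := {ξ | ξ.snd =ᵐ[μ] coeff π g ξ.fst}
  zero_mem' := by
    filter_upwards [Lp.coeFn_zero ℂ 2 μ] with x hx
    simp only [WithLp.zero_snd, WithLp.zero_fst, coeff, inner_zero_right]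
    exact hx
  add_mem' := by
    intro ξ η hξ hη
    change (ξ + η).snd =ᵐ[μ] coeff π g (ξ + η).fst
    filter_upwards [Lp.coeFn_add ξ.snd η.snd, hξ, hη] with x hx h1 h2
    rw [WithLp.add_snd, hx, Pi.add_apply, h1, h2, WithLp.add_fst, coeff_add]
  smul_mem' := by
    intro a ξ hξ
    change (a • ξ).snd =ᵐ[μ] coeff π g (a • ξ).fst
    filter_upwards [Lp.coeFn_smul a ξ.snd, hξ] with x hx h1
    rw [WithLp.smul_snd, hx, Pi.smul_apply, h1, WithLp.smul_fst, coeff_smul, smul_eq_mul]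

theorem mem_coeffGraph {μ : Measure G} {π : ProjRep G H} {g : H} {ξ : WithLp 2 (H × Lp ℂ 2 μ)} :
    ξ ∈ coeffGraph μ π g ↔ ξ.snd =ᵐ[μ] coeff π g ξ.fst := Iff.rfl

/-- An L²-convergent sequence converges almost everywhere along a subsequence, while V_g f depends
continuously on f at every point. -/
theorem isClosed_coeffGraph (μ : Measure G) (π : ProjRep G H) (g : H) :
    IsClosed (coeffGraph μ π g : Set (WithLp 2 (H × Lp ℂ 2 μ))) := by
  refine IsSeqClosed.isClosed fun u ξ hu hlim => ?_
  have h1 : Tendsto (fun n => (u n).fst) atTop (𝓝 ξ.fst) :=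
    ((WithLp.prod_continuous_ofLp 2 H (Lp ℂ 2 μ)).fst.tendsto ξ).comp hlim
  have h2 : Tendsto (fun n => (u n).snd) atTop (𝓝 ξ.snd) :=
    ((WithLp.prod_continuous_ofLp 2 H (Lp ℂ 2 μ)).snd.tendsto ξ).comp hlim
  obtain ⟨φ, hφ, hae⟩ := (tendstoInMeasure_of_tendsto_Lp h2).exists_seq_tendsto_ae
  have hall : ∀ᵐ x ∂μ, ∀ n, (u n).snd x = coeff π g (u n).fst x := ae_all_iff.2 fun n => hu n
  refine mem_coeffGraph.2 ?_
  filter_upwards [hae, hall] with x hx hn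
  refine tendsto_nhds_unique hx ?_
  simp only [hn]
  exact tendsto_const_nhds.inner (h1.comp hφ.tendsto_atTop)

theorem memLp_of_mem_coeffGraph {μ : Measure G} {π : ProjRep G H} {g : H}
    {ξ : WithLp 2 (H × Lp ℂ 2 μ)} (h : ξ ∈ coeffGraph μ π g) :
    MemLp (coeff π g ξ.fst) 2 μ :=
  (memLp_congr_ae (mem_coeffGraph.1 h)).1 (Lp.memLp ξ.snd)

/-- The point of the graph over a vector with square-integrable coefficient. -/
noncomputable def coeffGraph.mk {μ : Measure G} {π : ProjRep G H} {g : H} (f : H)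
    (hf : MemLp (coeff π g f) 2 μ) : coeffGraph μ π g :=
  ⟨WithLp.toLp 2 (f, hf.toLp _), hf.coeFn_toLp⟩

theorem coeffGraph.mk_fst {μ : Measure G} {π : ProjRep G H} {g : H} (f : H)
    (hf : MemLp (coeff π g f) 2 μ) : (coeffGraph.mk f hf : WithLp 2 (H × Lp ℂ 2 μ)).fst = f := rfl

theorem coeffGraph.ext {μ : Measure G} {π : ProjRep G H} {g : H} {ξ η : coeffGraph μ π g}
    (h : (ξ : WithLp 2 (H × Lp ℂ 2 μ)).fst = (η : WithLp 2 (H × Lp ℂ 2 μ)).fst) : ξ = η := by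
  refine Subtype.ext (WithLp.ofLp_injective 2 (Prod.ext h (Lp.ext ?_)))
  have h1 := mem_coeffGraph.1 ξ.2
  have h2 := mem_coeffGraph.1 η.2
  rw [← h] at h2
  exact h1.trans h2.symm

theorem coeffGraph.inner_eq {μ : Measure G} {π : ProjRep G H} {g : H} (ξ η : coeffGraph μ π g) :
    inner ℂ ξ η = inner ℂ (ξ : WithLp 2 (H × Lp ℂ 2 μ)).fst (η : WithLp 2 (H × Lp ℂ 2 μ)).fst +
      ∫ x, conj (coeff π g (ξ : WithLp 2 (H × Lp ℂ 2 μ)).fst x) *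
        coeff π g (η : WithLp 2 (H × Lp ℂ 2 μ)).fst x ∂μ := by
  rw [Submodule.coe_inner, WithLp.prod_inner_apply, L2.inner_def]
  congr 1
  refine integral_congr_ae ?_
  filter_upwards [mem_coeffGraph.1 ξ.2, mem_coeffGraph.1 η.2] with x h1 h2
  change inner ℂ ((ξ : WithLp 2 (H × Lp ℂ 2 μ)).snd x) ((η : WithLp 2 (H × Lp ℂ 2 μ)).snd x) = _
  rw [h1, h2, RCLike.inner_apply, mul_comm]

variable [MeasurableMul₂ G]

theorem memLp_coeff_apply_iff (μ : Measure G) [μ.IsMulLeftInvariant] (π : ProjRep G H) (g f : H)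
    (y : G) : MemLp (coeff π g (π y f)) 2 μ ↔ MemLp (coeff π g f) 2 μ := by
  have h1 : MemLp (coeff π g (π y f)) 2 μ ↔ MemLp (fun x => coeff π g f (y⁻¹ * x)) 2 μ :=
    memLp_congr_norm (stronglyMeasurable_coeff π g _).aestronglyMeasurable
      ((stronglyMeasurable_coeff π g f).comp_measurable
        (measurable_const_mul y⁻¹)).aestronglyMeasurable
      (ae_of_all _ fun x => norm_coeff_apply π g f y x)
  rw [h1]
  refine ⟨fun h => ?_, fun h => h.comp_measurePreserving (measurePreserving_mul_left μ y⁻¹)⟩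
  have := h.comp_measurePreserving (measurePreserving_mul_left μ y)
  simpa [Function.comp_def] using this

/-- For an irreducible representation, `V_g` is a multiple of an isometry as soon as one nonzero
vector has a square-integrable coefficient. -/
theorem IsIrreducible.exists_integral_norm_coeff_sq_eq [CompleteSpace H] (μ : Measure G)
    [μ.IsMulLeftInvariant] {π : ProjRep G H} (hπ : IsIrreducible π) {g f₀ : H} (hf₀ : f₀ ≠ 0)
    (h₀ : MemLp (coeff π g f₀) 2 μ) :
    ∃ c : ℝ, ∀ f, MemLp (coeff π g f) 2 μ ∧ ∫ x, ‖coeff π g f x‖ ^ 2 ∂μ = c * ‖f‖ ^ 2 := by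
  have : CompleteSpace (coeffGraph μ π g) :=
    (isClosed_coeffGraph μ π g).completeSpace_coe
  have : Nontrivial (coeffGraph μ π g) :=
    ⟨coeffGraph.mk f₀ h₀, 0, fun h => hf₀ (congrArg (fun ξ : coeffGraph μ π g => ξ.1.fst) h)⟩
  -- The domain of V_g is not known to be closed in H, so Schur's lemma is applied to the projection
  -- of the complete graph onto its first coordinate.
  let p : coeffGraph μ π g →L[ℂ] H :=
    (WithLp.fstL 2 ℂ H (Lp ℂ 2 μ)) ∘L (coeffGraph μ π g).subtypeL
  have hp : ∀ ξ, p ξ = ξ.1.fst := fun ξ => rfl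
  let ρ : G → coeffGraph μ π g → coeffGraph μ π g := fun x ξ =>
    coeffGraph.mk (π x ξ.1.fst) ((memLp_coeff_apply_iff μ π g _ x).2 (memLp_of_mem_coeffGraph ξ.2))
  obtain ⟨hsurj, c, -, hc⟩ := hπ.exists_norm_sq_eq p
    (fun ξ h => coeffGraph.ext (by rw [← hp, h]; rfl)) ρ (fun x ξ => rfl)
    (by
      intro x ξ η
      simp only [coeffGraph.inner_eq, ρ, coeffGraph.mk_fst, LinearIsometryEquiv.inner_map_map]
      congr 1
      rw [← integral_mul_left_eq_self
        (fun t => conj (coeff π g ξ.1.fst t) * coeff π g η.1.fst t) x⁻¹]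
      refine integral_congr_ae (ae_of_all _ fun t => ?_)
      obtain ⟨θ, hθ, h⟩ := exists_coeff_apply_eq π x t
      simp only [h]
      rw [map_mul, mul_mul_mul_comm, ← Complex.normSq_eq_conj_mul_self, Complex.normSq_eq_norm_sq,
        hθ]
      simp)
    (by
      intro x η
      refine ⟨coeffGraph.mk ((π x).symm η.1.fst) ?_, coeffGraph.ext ?_⟩
      · rw [← memLp_coeff_apply_iff μ π g _ x, LinearIsometryEquiv.apply_symm_apply]
        exact memLp_of_mem_coeffGraph η.2
      · simp only [ρ, coeffGraph.mk_fst, LinearIsometryEquiv.apply_symm_apply])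
  -- The squared graph norm is ‖f‖² + ‖V_g f‖², hence the subtraction of 1.
  refine ⟨c - 1, fun f => ?_⟩
  obtain ⟨ξ, rfl⟩ := hsurj f
  refine ⟨memLp_of_mem_coeffGraph ξ.2, ?_⟩
  have h1 := coeffGraph.inner_eq ξ ξ
  have h2 : ∫ x, conj (coeff π g ξ.1.fst x) * coeff π g ξ.1.fst x ∂μ =
      ((∫ x, ‖coeff π g (p ξ) x‖ ^ 2 ∂μ : ℝ) : ℂ) := by
    rw [← integral_complex_ofReal]
    refine integral_congr_ae (ae_of_all _ fun t => ?_)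
    simp only
    rw [← Complex.normSq_eq_conj_mul_self, Complex.normSq_eq_norm_sq, hp]
  rw [h2, inner_self_eq_norm_sq_to_K (𝕜 := ℂ) ξ, inner_self_eq_norm_sq_to_K, ← hp] at h1
  have h3 : ‖ξ‖ ^ 2 = ‖p ξ‖ ^ 2 + ∫ x, ‖coeff π g (p ξ) x‖ ^ 2 ∂μ := by
    apply Complex.ofReal_injective
    simpa using h1
  linarith [hc ξ]

end Graph

/-- Polarization: a biadditive form, linear in one argument and antilinear in the other with respect
to multiplication by `I`, vanishes if it vanishes on the diagonal. -/
theorem eq_zero_of_diag_eq_zero {E : Type*} [AddCommGroup E] [Module ℂ E] (b : E → E → ℂ) {s : ℂ}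
    (hs : s ≠ 0) (hl : ∀ x y z, b (x + y) z = b x z + b y z)
    (hr : ∀ x y z, b x (y + z) = b x y + b x z)
    (hsr : ∀ x y, b x (Complex.I • y) = s * b x y)
    (hsl : ∀ x y, b (Complex.I • y) x = -s * b y x)
    (h : ∀ x, b x x = 0) (x y : E) : b x y = 0 := by
  have h1 : ∀ x y, b x y + b y x = 0 := fun x y => by
    have := h (x + y)
    rw [hl, hr, hr, h, h] at this
    linear_combination this
  -- Replacing y by iy turns the antisymmetry `h1` into symmetry. The factor s is i or -i, according
  -- to which argument is linear.
  have h2 := h1 x (Complex.I • y)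
  rw [hsr, hsl] at h2
  have h3 : s * (2 * b x y) = 0 := by linear_combination h2 + s * h1 x y
  simpa [hs] using h3

/-! ### Orthogonality relations and the formal degree -/

section Orthogonality

variable {G H : Type*} [Group G] [TopologicalSpace G] [IsTopologicalGroup G]
    [LocallyCompactSpace G] [SecondCountableTopology G]
    [MeasurableSpace G] [BorelSpace G]
    (μ : Measure G) [μ.IsHaarMeasure] [μ.IsMulRightInvariant]
    [NormedAddCommGroup H] [InnerProductSpace ℂ H] {π : ProjRep G H}

/-- This is where unimodularity enters: |V_g f(x)| = |V_f g(x⁻¹)|, and inversion preserves μ. -/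
theorem memLp_coeff_swap_iff (g f : H) :
    MemLp (coeff π g f) 2 μ ↔ MemLp (coeff π f g) 2 μ := by
  have := isInvInvariant_of_isMulRightInvariant μ
  have key : ∀ g f : H, MemLp (coeff π f g) 2 μ → MemLp (coeff π g f) 2 μ := fun g f h => by
    have h1 := h.comp_measurePreserving (Measure.measurePreserving_inv μ)
    refine (memLp_congr_norm h1.1 (stronglyMeasurable_coeff π g f).aestronglyMeasurable
      (ae_of_all _ fun x => ?_)).1 h1
    exact (norm_coeff_inv π g f x).symm
  exact ⟨key f g, key g f⟩

theorem integral_norm_coeff_sq_swap (g f : H) :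
    ∫ x, ‖coeff π g f x‖ ^ 2 ∂μ = ∫ x, ‖coeff π f g x‖ ^ 2 ∂μ := by
  have := isInvInvariant_of_isMulRightInvariant μ
  rw [← integral_inv_eq_self (fun x => ‖coeff π f g x‖ ^ 2)]
  simp only [← norm_coeff_inv]

theorem IsDiscreteSeries.exists_integral_norm_coeff_sq_eq [CompleteSpace H]
    [TopologicalSpace.SeparableSpace H] (hπ : IsDiscreteSeries μ π) :
    ∃ d : ℝ, 0 < d ∧ ∀ g f : H, MemLp (coeff π g f) 2 μ ∧
      ∫ x, ‖coeff π g f x‖ ^ 2 ∂μ = d⁻¹ * ‖f‖ ^ 2 * ‖g‖ ^ 2 := by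
  obtain ⟨g₀, hg₀, hint⟩ := hπ.squareIntegrable
  have hL : MemLp (coeff π g₀ g₀) 2 μ := by
    refine ⟨(stronglyMeasurable_coeff π g₀ g₀).aestronglyMeasurable, ?_⟩
    rw [eLpNorm_lt_top_iff_lintegral_rpow_enorm_lt_top two_ne_zero ENNReal.ofNat_ne_top]
    simpa using hint
  obtain ⟨c, hc⟩ := hπ.irreducible.exists_integral_norm_coeff_sq_eq μ hg₀ hL
  have hn : 0 < ‖g₀‖ := norm_pos_iff.2 hg₀
  have hcpos : 0 < c := by
    have h1 : 0 < ∫ x, ‖coeff π g₀ g₀ x‖ ^ 2 ∂μ := by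
      refine (integral_pos_iff_support_of_nonneg (fun x => by positivity)
        (memLp_two_iff_integrable_sq_norm hL.1 |>.1 hL)).2 ?_
      have hcont : Continuous fun x => ‖coeff π g₀ g₀ x‖ ^ 2 :=
        (continuous_norm_coeff μ π g₀ g₀).pow 2
      refine hcont.isOpen_support.measure_pos μ ⟨1, ?_⟩
      rw [Function.mem_support, norm_coeff_one]
      simpa using hg₀
    rw [(hc g₀).2] at h1
    exact pos_of_mul_pos_left h1 (by positivity)
  -- Here ‖V_g f‖² = c'‖f‖² with c' depending on g; exchanging g and g₀ gives c'‖g₀‖² = c‖g‖², which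
  -- determines d.
  refine ⟨‖g₀‖ ^ 2 / c, by positivity, fun g f => ?_⟩
  obtain ⟨c', hc'⟩ := hπ.irreducible.exists_integral_norm_coeff_sq_eq μ hg₀
    ((memLp_coeff_swap_iff μ g g₀).2 (hc g).1)
  refine ⟨(hc' f).1, ?_⟩
  have h1 := (hc' g₀).2
  rw [integral_norm_coeff_sq_swap, (hc g).2] at h1
  rw [(hc' f).2]
  field_simp
  linear_combination -‖f‖ ^ 2 * h1

/-- The orthogonality relations: a formal degree exists. -/
theorem IsDiscreteSeries.exists_isFormalDegree [CompleteSpace H]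
    [TopologicalSpace.SeparableSpace H] (hπ : IsDiscreteSeries μ π) :
    ∃ d : ℝ, IsFormalDegree μ π d := by
  obtain ⟨d, hd, h⟩ := hπ.exists_integral_norm_coeff_sq_eq μ
  have hi : ∀ f₁ f₂ g₁ g₂ : H,
      Integrable (fun x => coeff π g₁ f₁ x * conj (coeff π g₂ f₂ x)) μ := fun f₁ f₂ g₁ g₂ =>
    (h g₁ f₁).1.integrable_mul (h g₂ f₂).1.star
  refine ⟨d, hd, fun f₁ f₂ g₁ g₂ => ⟨hi _ _ _ _, ?_⟩⟩
  -- The defect of the relations. It vanishes for equal pairs and is polarized in f first, then in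
  -- g.
  let b : H → H → H → H → ℂ := fun g₁ g₂ f₁ f₂ =>
    ∫ x, coeff π g₁ f₁ x * conj (coeff π g₂ f₂ x) ∂μ
      - (d : ℂ)⁻¹ * inner ℂ f₂ f₁ * conj (inner ℂ g₂ g₁)
  have hI : -Complex.I ≠ 0 := neg_ne_zero.2 Complex.I_ne_zero
  have h1 : ∀ g f₁ f₂, b g g f₁ f₂ = 0 := by
    intro g
    refine eq_zero_of_diag_eq_zero (b g g) hI ?_ ?_ ?_ ?_ ?_
    · intro x y z
      simp only [b, coeff_add, add_mul, inner_add_right, integral_add (hi x z g g) (hi y z g g)]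
      ring
    · intro x y z
      simp only [b, coeff_add, map_add, mul_add, inner_add_left,
        integral_add (hi x y g g) (hi x z g g)]
      ring
    · intro x y
      simp only [b, coeff_smul, map_mul, Complex.conj_I, mul_left_comm _ (-Complex.I),
        integral_const_mul, inner_smul_left]
      ring
    · intro x y
      simp only [b, coeff_smul, mul_assoc, integral_const_mul, inner_smul_right]
      ring
    · intro f
      have h2 : ∫ x, coeff π g f x * conj (coeff π g f x) ∂μ =
          ((∫ x, ‖coeff π g f x‖ ^ 2 ∂μ : ℝ) : ℂ) := by
        rw [← integral_complex_ofReal]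
        refine integral_congr_ae (ae_of_all _ fun t => ?_)
        simp only
        rw [Complex.mul_conj, Complex.normSq_eq_norm_sq]
      simp only [b]
      rw [h2, (h g f).2, inner_self_eq_norm_sq_to_K, inner_self_eq_norm_sq_to_K]
      simp
  have h2 : ∀ g₁ g₂, b g₁ g₂ f₁ f₂ = 0 := by
    refine eq_zero_of_diag_eq_zero (fun g₁ g₂ => b g₁ g₂ f₁ f₂) Complex.I_ne_zero ?_ ?_ ?_ ?_
      (fun g => h1 g f₁ f₂)
    · intro x y z
      simp only [b, coeff_add_left, add_mul, inner_add_right, map_add,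
        integral_add (hi f₁ f₂ x z) (hi f₁ f₂ y z)]
      ring
    · intro x y z
      simp only [b, coeff_add_left, map_add, mul_add, inner_add_left,
        integral_add (hi f₁ f₂ x y) (hi f₁ f₂ x z)]
      ring
    · intro x y
      simp only [b, coeff_smul_left, map_mul, Complex.conj_conj, mul_left_comm _ Complex.I,
        integral_const_mul, inner_smul_left]
      ring
    · intro x y
      simp only [b, coeff_smul_left, mul_assoc, integral_const_mul, inner_smul_right, map_mul,
        Complex.conj_I]
      ring
  exact sub_eq_zero.1 (h2 g₁ g₂)

theorem IsDiscreteSeries.isFormalDegree_formalDegree [CompleteSpace H]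
    [TopologicalSpace.SeparableSpace H] (hπ : IsDiscreteSeries μ π) :
    IsFormalDegree μ π (formalDegree μ π) := by
  have h := hπ.exists_isFormalDegree μ
  rw [formalDegree, dif_pos h]
  exact h.choose_spec

end Orthogonality

theorem IsFormalDegree.lintegral_enorm_coeff_sq {G H : Type*} [Group G] [MeasurableSpace G]
    [NormedAddCommGroup H] [InnerProductSpace ℂ H] {μ : Measure G} {π : ProjRep G H} {d : ℝ}
    (hd : IsFormalDegree μ π d) (g f : H) :
    ENNReal.ofReal d * ∫⁻ x, ‖coeff π g f x‖ₑ ^ 2 ∂μ = ‖f‖ₑ ^ 2 * ‖g‖ₑ ^ 2 := by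
  obtain ⟨hi, he⟩ := hd.2 f f g g
  have hsq : ∀ x, coeff π g f x * conj (coeff π g f x) = ((‖coeff π g f x‖ ^ 2 : ℝ) : ℂ) :=
    fun x => by rw [Complex.mul_conj, Complex.normSq_eq_norm_sq]
  simp only [hsq] at hi he
  have hi' : Integrable (fun x => ‖coeff π g f x‖ ^ 2) μ := hi.re
  have he' : ∫ x, ‖coeff π g f x‖ ^ 2 ∂μ = d⁻¹ * ‖f‖ ^ 2 * ‖g‖ ^ 2 := by
    apply Complex.ofReal_injective
    rw [← integral_complex_ofReal, he, inner_self_eq_norm_sq_to_K, inner_self_eq_norm_sq_to_K]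
    simp
  have hl : ∫⁻ x, ‖coeff π g f x‖ₑ ^ 2 ∂μ = ENNReal.ofReal (∫ x, ‖coeff π g f x‖ ^ 2 ∂μ) := by
    rw [ofReal_integral_eq_lintegral_ofReal hi' (ae_of_all _ fun x => by positivity)]
    refine lintegral_congr fun x => ?_
    rw [ENNReal.ofReal_pow (norm_nonneg _), ofReal_norm]
  rw [hl, he', ← ENNReal.ofReal_mul hd.1.le, ← ofReal_norm f, ← ofReal_norm g,
    ← ENNReal.ofReal_pow (norm_nonneg _), ← ENNReal.ofReal_pow (norm_nonneg _),
    ← ENNReal.ofReal_mul (by positivity)]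
  congr 1
  have := hd.1.ne'
  field_simp

/-! ### Local maximal functions -/

section LocalMax

variable {G : Type*} [Group G]

theorem enorm_le_localMax [MeasurableSpace G] {Q : Set G} (F : G → ℂ) (x : G) {z : G}
    (hz : z ∈ Q) : ‖F (x * z)‖ₑ ≤ localMax Q F x := le_iSup₂ (f := fun z _ => ‖F (x * z)‖ₑ) z hz

variable [TopologicalSpace G] [IsTopologicalGroup G]

/-- A relatively compact set is covered by finitely many translates of a unit neighborhood. -/
theorem IsSymmUnitNhd.exists_finset_subset {Q : Set G} (hQ : IsSymmUnitNhd Q) {U : Set G}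
    (hU : U ∈ 𝓝 (1 : G)) : ∃ t : Finset G, ∀ z ∈ Q, ∃ q ∈ t, q⁻¹ * z ∈ U := by
  obtain ⟨t, -, ht⟩ := hQ.relCompact.elim_nhds_subcover (fun q => (fun z => q⁻¹ * z) ⁻¹' U)
    (fun q _ => (continuous_const_mul q⁻¹).continuousAt.preimage_mem_nhds (by simpa using hU))
  refine ⟨t, fun z hz => ?_⟩
  simpa using ht (subset_closure hz)

variable [MeasurableSpace G] [BorelSpace G]

theorem measurable_localMax (Q : Set G) {F : G → ℂ} (hF : Continuous fun x => ‖F x‖) :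
    Measurable (localMax Q F) := by
  refine LowerSemicontinuous.measurable (lowerSemicontinuous_biSup fun z _ => ?_)
  have h : Continuous fun x => ENNReal.ofReal ‖F (x * z)‖ :=
    ENNReal.continuous_ofReal.comp (hF.comp (continuous_mul_const z))
  simp only [ofReal_norm] at h
  exact h.lowerSemicontinuous

/-- Finitely many translates qU cover Q, so M_Q F(x) is dominated by the values M_U F(xq), and right
translation preserves the integral. -/
theorem lintegral_localMax_sq_lt_top (μ : Measure G) [μ.IsMulRightInvariant] {F : G → ℂ}
    (hF : Continuous fun x => ‖F x‖) {U Q : Set G} (hU : U ∈ 𝓝 (1 : G)) (hQ : IsSymmUnitNhd Q)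
    (h : ∫⁻ x, localMax U F x ^ 2 ∂μ < ∞) : ∫⁻ x, localMax Q F x ^ 2 ∂μ < ∞ := by
  obtain ⟨t, ht⟩ := hQ.exists_finset_subset hU
  have hle : ∀ x, localMax Q F x ^ 2 ≤ ∑ q ∈ t, localMax U F (x * q) ^ 2 := by
    intro x
    have hS : localMax Q F x ≤ (∑ q ∈ t, localMax U F (x * q) ^ 2) ^ (2⁻¹ : ℝ) := by
      refine iSup₂_le fun z hz => ?_
      obtain ⟨q, hq, hz'⟩ := ht z hz
      have h1 : ‖F (x * z)‖ₑ ≤ localMax U F (x * q) := by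
        have := enorm_le_localMax F (x * q) hz'
        rwa [mul_assoc, mul_inv_cancel_left] at this
      rw [ENNReal.le_rpow_inv_iff two_pos, ENNReal.rpow_two]
      exact (pow_le_pow_left' h1 2).trans
        (Finset.single_le_sum (f := fun q => localMax U F (x * q) ^ 2) (fun _ _ => zero_le) hq)
    rwa [ENNReal.le_rpow_inv_iff two_pos, ENNReal.rpow_two] at hS
  refine (lintegral_mono hle).trans_lt ?_
  have hm := (measurable_localMax U hF).pow_const 2
  have hmq : ∀ q, Measurable fun x => localMax U F (x * q) ^ 2 := fun q =>
    hm.comp (measurable_mul_const q)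
  rw [lintegral_finsetSum t fun q _ => hmq q]
  refine ENNReal.sum_lt_top.2 fun q _ => ?_
  rwa [lintegral_mul_right_eq_self (fun x => localMax U F x ^ 2) q]

end LocalMax

/-! ### Boundary terms along Følner sequences -/

section Folner

theorem measure_mul_le {G : Type*} [Group G] [MeasurableSpace G] {μ : Measure G}
    {K L : Set G} (h1 : (1 : G) ∈ L) :
    μ (K * L) ≤ μ K + μ ((K * L) ∩ (Kᶜ * L)) := by
  refine (measure_mono fun x hx => ?_).trans (measure_union_le _ _)
  by_cases hxK : x ∈ K
  · exact Or.inl hxK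
  · exact Or.inr ⟨hx, x, hxK, 1, h1, mul_one x⟩

/-- Adjoining w to L places yw in both factors of a Følner boundary, for each y in the set on the
left. -/
theorem measure_compl_inter_preimage_le {G : Type*} [Group G] [MeasurableSpace G] [MeasurableMul G]
    {μ : Measure G} [μ.IsMulRightInvariant] (K L : Set G) (w : G) :
    μ (Kᶜ ∩ (fun y => y * w) ⁻¹' (K * L)) ≤ μ ((K * insert w L) ∩ (Kᶜ * insert w L)) := by
  have : Kᶜ ∩ (fun y => y * w) ⁻¹' (K * L) ⊆
      (fun y => y * w) ⁻¹' ((K * insert w L) ∩ (Kᶜ * insert w L)) := by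
    rintro y ⟨hy, hyw⟩
    exact ⟨mul_subset_mul_left (subset_insert _ _) hyw, mul_mem_mul hy (mem_insert _ _)⟩
  exact (measure_mono this).trans_eq (measure_preimage_mul_right μ w _)

variable {G : Type*} [Group G] [TopologicalSpace G] [IsTopologicalGroup G]
    [LocallyCompactSpace G] [SecondCountableTopology G]
    [MeasurableSpace G] [BorelSpace G]
    (μ : Measure G) [μ.IsHaarMeasure]

/-- Substituting `w = y⁻¹ z` in a double integral over `S × T`. -/
theorem lintegral_lintegral_inv_mul_eq (Φ : G → ℝ≥0∞) (hΦ : Measurable Φ) {S T : Set G}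
    (hT : MeasurableSet T) :
    ∫⁻ y in S, ∫⁻ z in T, Φ (y⁻¹ * z) ∂μ ∂μ =
      ∫⁻ w, Φ w * μ (S ∩ (fun y => y * w) ⁻¹' T) ∂μ := by
  have hm2 : Measurable fun p : G × G => Φ p.2 * T.indicator 1 (p.1 * p.2) := by
    refine (hΦ.comp measurable_snd).mul ?_
    exact (measurable_one.indicator hT).comp (measurable_fst.mul measurable_snd)
  calc ∫⁻ y in S, ∫⁻ z in T, Φ (y⁻¹ * z) ∂μ ∂μ
      = ∫⁻ y in S, ∫⁻ w, Φ w * T.indicator 1 (y * w) ∂μ ∂μ := by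
        refine lintegral_congr fun y => ?_
        rw [← lintegral_indicator hT, ← lintegral_mul_left_eq_self _ y]
        refine lintegral_congr fun w => ?_
        by_cases h : y * w ∈ T <;> simp [h]
    _ = ∫⁻ w, ∫⁻ y in S, Φ w * T.indicator 1 (y * w) ∂μ ∂μ :=
        lintegral_lintegral_swap hm2.aemeasurable
    _ = _ := by
        refine lintegral_congr fun w => ?_
        have hTw : MeasurableSet ((fun y => y * w) ⁻¹' T) := measurable_mul_const w hT
        have hmw : Measurable fun y => T.indicator (1 : G → ℝ≥0∞) (y * w) :=
          (measurable_one.indicator hT).comp (measurable_mul_const w)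
        rw [lintegral_const_mul _ hmw]
        congr 1
        have : (fun y => T.indicator (1 : G → ℝ≥0∞) (y * w)) =
            ((fun y => y * w) ⁻¹' T).indicator 1 := by
          funext y; rfl
        rw [this, lintegral_indicator_one hTw, Measure.restrict_apply hTw, inter_comm]

variable {μ} [μ.IsMulRightInvariant]

/-- The boundary interaction of an integrable kernel along a strong Følner sequence. -/
theorem IsStrongFolner.tendsto_lintegral_div {K : ℕ → Set G} (hK : IsStrongFolner μ K)
    [T2Space G] {Φ : G → ℝ≥0∞} (hΦ : Measurable Φ) (hΦi : ∫⁻ w, Φ w ∂μ < ∞) {L : Set G}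
    (hL : IsCompact L) (h1 : (1 : G) ∈ L) :
    Tendsto (fun n => (∫⁻ y in (K n)ᶜ, ∫⁻ z in K n * L, Φ (y⁻¹ * z) ∂μ ∂μ) / μ (K n))
      atTop (𝓝 0) := by
  have hfin : ∀ n, μ (K n) ≠ ∞ := fun n => (hK.isCompact n).measure_lt_top.ne
  have hKm : ∀ n, MeasurableSet (K n) := fun n => (hK.isCompact n).measurableSet
  have hKL : ∀ n, MeasurableSet (K n * L) := fun n => ((hK.isCompact n).mul hL).measurableSet
  let a : ℕ → G → ℝ≥0∞ := fun n w => μ ((K n)ᶜ ∩ (fun y => y * w) ⁻¹' (K n * L)) / μ (K n)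
  have ham : ∀ n, Measurable (a n) := by
    intro n
    refine Measurable.div_const ?_ _
    have hs : MeasurableSet {p : G × G | p.2 ∈ (K n)ᶜ ∧ p.2 * p.1 ∈ K n * L} :=
      (measurable_snd (hKm n).compl).inter ((measurable_snd.mul measurable_fst) (hKL n))
    exact measurable_measure_prodMk_left hs
  have heq : ∀ n, (∫⁻ y in (K n)ᶜ, ∫⁻ z in K n * L, Φ (y⁻¹ * z) ∂μ ∂μ) / μ (K n) =
      ∫⁻ w, Φ w * a n w ∂μ := by
    intro n
    rw [lintegral_lintegral_inv_mul_eq μ Φ hΦ (hKL n), div_eq_mul_inv,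
      ← lintegral_mul_const' _ _ (ENNReal.inv_ne_top.2 (hK.nonnull n))]
    refine lintegral_congr fun w => ?_
    rw [mul_assoc]; rfl
  -- μ(KL) is at most μ(K) plus the Følner boundary of K, which is eventually smaller than μ(K).
  have hbound : ∀ᶠ n in atTop, ∀ w, a n w ≤ 2 := by
    have h2 := (hK.tendsto L hL).eventually (gt_mem_nhds (show (0 : ℝ≥0∞) < 1 by simp))
    filter_upwards [h2] with n hn w
    have h3 : μ ((K n)ᶜ ∩ (fun y => y * w) ⁻¹' (K n * L)) ≤ μ (K n * L) :=
      (measure_mono inter_subset_right).trans_eq (measure_preimage_mul_right μ w _)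
    have h4 := h3.trans (measure_mul_le h1)
    refine (ENNReal.div_le_div_right h4 _).trans ?_
    rw [ENNReal.add_div, ENNReal.div_self (hK.nonnull n) (hfin n), ← one_add_one_eq_two]
    gcongr
  have hpt : ∀ w, Tendsto (fun n => a n w) atTop (𝓝 0) := by
    intro w
    refine tendsto_of_tendsto_of_tendsto_of_le_of_le tendsto_const_nhds
      (hK.tendsto (insert w L) (hL.insert w)) (fun n => zero_le) fun n => ?_
    exact ENNReal.div_le_div_right (measure_compl_inter_preimage_le _ _ w) _
  simp only [heq]
  have hΦfin : ∀ᵐ w ∂μ, Φ w < ∞ := ae_lt_top hΦ hΦi.ne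
  have := tendsto_lintegral_filter_of_dominated_convergence (μ := μ)
    (F := fun n w => Φ w * a n w) (f := fun _ => 0) (l := atTop) (fun w => Φ w * 2)
    (Eventually.of_forall fun n => hΦ.mul (ham n))
    (hbound.mono fun n hn => ae_of_all _ fun w => by gcongr; exact hn w)
    (by rw [lintegral_mul_const _ hΦ]; exact ENNReal.mul_ne_top hΦi.ne (by simp))
    (by
      filter_upwards [hΦfin] with w hw
      simpa using ENNReal.Tendsto.const_mul (hpt w) (Or.inr hw.ne))
  simpa using this

theorem lintegral_compl_mul_lt_top [T2Space G] {K L : Set G} (hK : IsCompact K) (hL : IsCompact L)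
    {Φ : G → ℝ≥0∞} (hΦ : Measurable Φ) (hΦi : ∫⁻ w, Φ w ∂μ < ∞) :
    ∫⁻ y in Kᶜ, ∫⁻ z in K * L, Φ (y⁻¹ * z) ∂μ ∂μ < ∞ := by
  rw [lintegral_lintegral_inv_mul_eq μ Φ hΦ (hK.mul hL).measurableSet]
  calc _ ≤ ∫⁻ w, Φ w * μ (K * L) ∂μ := by
        refine lintegral_mono fun w => ?_
        exact mul_le_mul_right ((measure_mono inter_subset_right).trans_eq
          (measure_preimage_mul_right μ w _)) _
    _ = (∫⁻ w, Φ w ∂μ) * μ (K * L) := lintegral_mul_const _ hΦ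
    _ < ∞ := ENNReal.mul_lt_top hΦi (hK.mul hL).measure_lt_top

end Folner

/-! ### Finiteness and asymptotics of J -/

section RieszError

/-- KQ need not be measurable; for compact K and relatively compact Q, passing to the closure of Q
makes the region compact. -/
theorem rieszError_le {G H : Type*} [Group G] [TopologicalSpace G] [MeasurableSpace G]
    [NormedAddCommGroup H] [InnerProductSpace ℂ H] (μ : Measure G) (π : ProjRep G H)
    (g : H) (Q K : Set G) :
    rieszError μ π g Q K ≤ ∫⁻ y in Kᶜ, ∫⁻ z in K * closure Q,
      localMax Q (coeff π g g) (y⁻¹ * z) ^ 2 ∂μ ∂μ :=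
  lintegral_mono fun _ => lintegral_mono' (Measure.restrict_mono_set μ
    (mul_subset_mul_left subset_closure)) le_rfl

variable {G H : Type*} [Group G] [TopologicalSpace G] [IsTopologicalGroup G]
    [LocallyCompactSpace G] [SecondCountableTopology G]
    [MeasurableSpace G] [BorelSpace G]
    {μ : Measure G} [μ.IsHaarMeasure] [μ.IsMulRightInvariant]
    [NormedAddCommGroup H] [InnerProductSpace ℂ H] [TopologicalSpace.SeparableSpace H]
    {π : ProjRep G H} {Q : Set G} {g : H}

theorem lintegral_localMax_coeff_lt_top (hQ : IsSymmUnitNhd Q) (hg : g ∈ localized μ π) :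
    ∫⁻ x, localMax Q (coeff π g g) x ^ 2 ∂μ < ∞ := by
  obtain ⟨U, hU, h⟩ := hg
  exact lintegral_localMax_sq_lt_top μ (continuous_norm_coeff μ π g g) hU.mem_nhds hQ h

variable [T2Space G]

theorem rieszError_lt_top (hQ : IsSymmUnitNhd Q) (hg : g ∈ localized μ π) {K : Set G}
    (hK : IsCompact K) : rieszError μ π g Q K < ∞ :=
  (rieszError_le μ π g Q K).trans_lt <| lintegral_compl_mul_lt_top hK hQ.relCompact
    ((measurable_localMax Q (continuous_norm_coeff μ π g g)).pow_const 2)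
    (lintegral_localMax_coeff_lt_top hQ hg)

theorem rieszError_isLittleO (hQ : IsSymmUnitNhd Q) (hg : g ∈ localized μ π) {K : ℕ → Set G}
    (hK : IsStrongFolner μ K) :
    (fun n => (rieszError μ π g Q (K n)).toReal) =o[atTop] (fun n => (μ (K n)).toReal) := by
  have h := hK.tendsto_lintegral_div
    ((measurable_localMax Q (continuous_norm_coeff μ π g g)).pow_const 2)
    (lintegral_localMax_coeff_lt_top hQ hg) hQ.relCompact
    (subset_closure (mem_of_mem_nhds hQ.mem_nhds))
  have h2 : Tendsto (fun n => rieszError μ π g Q (K n) / μ (K n)) atTop (𝓝 0) :=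
    tendsto_of_tendsto_of_tendsto_of_le_of_le tendsto_const_nhds h (fun n => zero_le)
      fun n => ENNReal.div_le_div_right (rieszError_le μ π g Q (K n)) _
  refine (Asymptotics.isLittleO_iff_tendsto fun n hn => ?_).2 ?_
  · have := (ENNReal.toReal_eq_zero_iff _).1 hn
    exact absurd this (by simp [hK.nonnull n, (hK.isCompact n).measure_lt_top.ne])
  · have := (ENNReal.tendsto_toReal ENNReal.zero_ne_top).comp h2
    simpa [Function.comp_def, ENNReal.toReal_div] using this

end RieszError

/-! ### Riesz bounds for finite families -/

section FiniteRiesz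

variable {ι H : Type*} [Fintype ι] [NormedAddCommGroup H] [InnerProductSpace ℂ H] {v : ι → H}

/-- Bessel's inequality for a finite family with an upper Riesz bound. -/
theorem sum_norm_inner_sq_le_of_upper_bound {B : ℝ} (hB : 0 ≤ B)
    (h : ∀ a : ι → ℂ, ‖∑ i, a i • v i‖ ^ 2 ≤ B * ∑ i, ‖a i‖ ^ 2) (f : H) :
    ∑ i, ‖inner ℂ (v i) f‖ ^ 2 ≤ B * ‖f‖ ^ 2 := by
  -- Testing the upper bound with the coefficients ⟨f, v_i⟩ gives S² ≤ B S ‖f‖².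
  set S := ∑ i, ‖inner ℂ (v i) f‖ ^ 2 with hS
  have hS0 : 0 ≤ S := by positivity
  have h1 : ‖inner ℂ (∑ i, inner ℂ (v i) f • v i) f‖ = S := by
    have : inner ℂ (∑ i, inner ℂ (v i) f • v i) f = ((S : ℝ) : ℂ) := by
      rw [sum_inner, hS, Complex.ofReal_sum]
      refine Finset.sum_congr rfl fun i _ => ?_
      rw [inner_smul_left, ← Complex.normSq_eq_conj_mul_self, Complex.normSq_eq_norm_sq]
    rw [this, Complex.norm_real, Real.norm_of_nonneg hS0]
  have h2 : S ^ 2 ≤ B * S * ‖f‖ ^ 2 := by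
    calc S ^ 2 ≤ (‖∑ i, inner ℂ (v i) f • v i‖ * ‖f‖) ^ 2 := by
          have := norm_inner_le_norm (𝕜 := ℂ) (∑ i, inner ℂ (v i) f • v i) f
          rw [h1] at this
          gcongr
      _ = ‖∑ i, inner ℂ (v i) f • v i‖ ^ 2 * ‖f‖ ^ 2 := mul_pow _ _ _
      _ ≤ B * S * ‖f‖ ^ 2 := by gcongr; exact h _
  rcases hS0.eq_or_lt with h0 | h0
  · rw [← h0]; positivity
  · refine le_of_mul_le_mul_left ?_ h0
    linarith

/-- The lower frame inequality on the span of a finite family with a lower Riesz bound. -/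
theorem mul_norm_sq_le_sum_norm_inner_sq {A : ℝ}
    (h : ∀ a : ι → ℂ, A * ∑ i, ‖a i‖ ^ 2 ≤ ‖∑ i, a i • v i‖ ^ 2) {f : H}
    (hf : f ∈ Submodule.span ℂ (range v)) :
    A * ‖f‖ ^ 2 ≤ ∑ i, ‖inner ℂ (v i) f‖ ^ 2 := by
  rcases le_or_gt A 0 with hA | hA
  · exact (mul_nonpos_of_nonpos_of_nonneg hA (by positivity)).trans (by positivity)
  obtain ⟨a, rfl⟩ := (Submodule.mem_span_range_iff_exists_fun ℂ).1 hf
  set f := ∑ i, a i • v i with hfdef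
  set S := ∑ i, ‖inner ℂ (v i) f‖ ^ 2
  have h1 : ‖f‖ ^ 2 ≤ ∑ i, ‖a i‖ * ‖inner ℂ (v i) f‖ := by
    have h2 : inner ℂ f f = ∑ i, conj (a i) * inner ℂ (v i) f := by
      conv_lhs => rw [hfdef, sum_inner]
      simp only [inner_smul_left]
      rfl
    calc ‖f‖ ^ 2 = ‖inner ℂ f f‖ := by
          rw [inner_self_eq_norm_sq_to_K]; simp
      _ ≤ ∑ i, ‖conj (a i) * inner ℂ (v i) f‖ := by rw [h2]; exact norm_sum_le _ _
      _ = _ := by simp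
  have h3 : A * (‖f‖ ^ 2) ^ 2 ≤ ‖f‖ ^ 2 * S := by
    calc A * (‖f‖ ^ 2) ^ 2 ≤ A * (∑ i, ‖a i‖ * ‖inner ℂ (v i) f‖) ^ 2 := by gcongr
      _ ≤ A * ((∑ i, ‖a i‖ ^ 2) * S) := by
        gcongr; exact Finset.sum_mul_sq_le_sq_mul_sq _ _ _
      _ = (A * ∑ i, ‖a i‖ ^ 2) * S := by ring
      _ ≤ ‖f‖ ^ 2 * S := by gcongr; exact h a
  rcases (sq_nonneg ‖f‖).eq_or_lt with h0 | h0
  · rw [← h0, mul_zero]; positivity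
  · refine le_of_mul_le_mul_left ?_ h0
    linarith

theorem linearIndependent_of_lower_bound {A : ℝ} (hA : 0 < A)
    (h : ∀ a : ι → ℂ, A * ∑ i, ‖a i‖ ^ 2 ≤ ‖∑ i, a i • v i‖ ^ 2) : LinearIndependent ℂ v := by
  refine Fintype.linearIndependent_iff.2 fun a ha i => ?_
  have h1 := h a
  rw [ha, norm_zero, zero_pow two_ne_zero] at h1
  have h2 : ∑ i, ‖a i‖ ^ 2 ≤ 0 := nonpos_of_mul_nonpos_right h1 hA
  have h3 := (Finset.single_le_sum (f := fun i => ‖a i‖ ^ 2) (fun _ _ => by positivity)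
    (Finset.mem_univ i)).trans h2
  simpa using h3

end FiniteRiesz

/-! ### Relative separation from the upper Riesz bound -/

section Counting

variable {G H : Type*} [Group G] [MeasurableSpace G] [NormedAddCommGroup H]
  [InnerProductSpace ℂ H] {π : ProjRep G H} {Λ : Set G} {g : H} {A B : ℝ}

/-- The Riesz inequalities for finite subfamilies. -/
theorem IsRieszSeq.finset_bounds (h : IsRieszSeq π Λ g A B) {F : Finset G} (hF : (F : Set G) ⊆ Λ)
    (a : F → ℂ) : A * ∑ t, ‖a t‖ ^ 2 ≤ ‖∑ t, a t • π (t : G) g‖ ^ 2 ∧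
      ‖∑ t, a t • π (t : G) g‖ ^ 2 ≤ B * ∑ t, ‖a t‖ ^ 2 := by
  let j : F → Λ := fun t => ⟨t, hF t.2⟩
  have hj : Function.Injective j := fun s t hst => Subtype.ext (congrArg (fun u : Λ => (u : G)) hst)
  let c₀ : Λ → ℂ := Function.extend j a 0
  have hcj : ∀ t, c₀ (j t) = a t := fun t => hj.extend_apply a 0 t
  have hc0 : ∀ u, u ∉ range j → c₀ u = 0 := fun u hu =>
    Function.extend_apply' _ _ u (fun ⟨t, ht⟩ => hu ⟨t, ht⟩)
  have hmem : Memℓp c₀ 2 := by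
    refine (memℓp_zero ((finite_range j).subset fun u hu => ?_)).of_exponent_ge zero_le
    by_contra hn
    exact hu (hc0 u hn)
  let c : lp (fun _ : Λ => ℂ) 2 := ⟨c₀, hmem⟩
  obtain ⟨-, h1, h2⟩ := h.2.2 c
  have hs1 : ∑' t : Λ, c t • π (t : G) g = ∑ t, a t • π (t : G) g := by
    rw [← hj.tsum_eq (f := fun t : Λ => c t • π (t : G) g), tsum_fintype]
    · exact Finset.sum_congr rfl fun t _ => by rw [← hcj t]
    · intro u hu
      by_contra hn
      exact hu (by simp only [c, hc0 u hn, zero_smul])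
  have hs2 : ‖c‖ ^ 2 = ∑ t, ‖a t‖ ^ 2 := by
    have h3 := lp.norm_rpow_eq_tsum (p := 2) (by norm_num) c
    simp only [ENNReal.toReal_ofNat, Real.rpow_two] at h3
    rw [h3, ← hj.tsum_eq (f := fun t : Λ => ‖c t‖ ^ 2), tsum_fintype]
    · exact Finset.sum_congr rfl fun t _ => by rw [← hcj t]
    · intro u hu
      by_contra hn
      exact hu (by simp only [c, hc0 u hn, norm_zero, zero_pow two_ne_zero])
  rw [hs1, hs2] at h1 h2
  exact ⟨h1, h2⟩

/-- The number of points of `Λ` in a translate of a set where `V_g g` is large is bounded by the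
upper Riesz bound. -/
theorem IsRieszSeq.card_filter_mul_le (h : IsRieszSeq π Λ g A B) {F : Finset G}
    (hF : (F : Set G) ⊆ Λ) {U : Set G} {r : ℝ} (hr : 0 ≤ r) (hU : ∀ u ∈ U, r ≤ ‖coeff π g g u‖)
    (z : G) [DecidablePred fun t => z⁻¹ * t ∈ U] :
    ((F.filter fun t => z⁻¹ * t ∈ U).card : ℝ) * r ^ 2 ≤ B * ‖g‖ ^ 2 := by
  have h1 := sum_norm_inner_sq_le_of_upper_bound h.2.1.le (fun a => (h.finset_bounds hF a).2)
    (π z g)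
  rw [LinearIsometryEquiv.norm_map,
    Finset.sum_coe_sort F fun t => ‖inner ℂ (π t g) (π z g)‖ ^ 2] at h1
  refine le_trans ?_ h1
  rw [← nsmul_eq_mul]
  refine (Finset.card_nsmul_le_sum _ (fun t => ‖inner ℂ (π t g) (π z g)‖ ^ 2) _
    fun t ht => ?_).trans
    (Finset.sum_le_sum_of_subset_of_nonneg (Finset.filter_subset _ _) fun _ _ _ => by positivity)
  have h2 : ‖inner ℂ (π t g) (π z g)‖ = ‖coeff π g g (z⁻¹ * t)‖ := by
    rw [norm_inner_symm, π.norm_inner_apply_apply, norm_inner_symm, coeff]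
  rw [h2]
  have := hU _ (Finset.mem_filter.1 ht).2
  gcongr

end Counting

section Density

variable {G H : Type*} [Group G] [TopologicalSpace G] [IsTopologicalGroup G]
    [LocallyCompactSpace G] [SecondCountableTopology G]
    [MeasurableSpace G] [BorelSpace G]
    [NormedAddCommGroup H] [InnerProductSpace ℂ H] [TopologicalSpace.SeparableSpace H]

/-- The sets generating Riesz sequences with upper bound `B` are uniformly relatively separated. -/
theorem exists_card_filter_le (π : ProjRep G H) {Q : Set G} (hQ : IsSymmUnitNhd Q) {g : H}
    (hg : g ≠ 0) (A B : ℝ) :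
    ∃ R : ℝ, ∀ Λ : Set G, IsRieszSeq π Λ g A B → ∀ F : Finset G, (F : Set G) ⊆ Λ →
      ∀ z : G, ∀ F' ⊆ F, (∀ t ∈ F', z⁻¹ * t ∈ Q) → (F'.card : ℝ) ≤ R := by
  classical
  have hn : 0 < ‖g‖ := norm_pos_iff.2 hg
  let U : Set G := {u | ‖g‖ ^ 2 / 2 < ‖coeff π g g u‖}
  have hU : U ∈ 𝓝 (1 : G) := by
    refine (isOpen_lt continuous_const (continuous_norm_coeff Measure.haar π g g)).mem_nhds ?_
    change _ < ‖coeff π g g 1‖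
    have : ‖inner ℂ g g‖ = ‖g‖ ^ 2 := by rw [inner_self_eq_norm_sq_to_K]; simp
    rw [norm_coeff_one, this]
    exact half_lt_self (by positivity)
  obtain ⟨s, hs⟩ := hQ.exists_finset_subset hU
  -- Each of the translates of U covering Q contains at most 4B/‖g‖² points, by Bessel with r =
  -- ‖g‖²/2.
  refine ⟨s.card * (4 * B / ‖g‖ ^ 2), fun Λ hΛ F hF z F' hF' hz => ?_⟩
  have hq : ∀ q ∈ s, ((F.filter fun t => (z * q)⁻¹ * t ∈ U).card : ℝ) ≤ 4 * B / ‖g‖ ^ 2 := by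
    intro q _
    have h1 := hΛ.card_filter_mul_le hF (U := U) (by positivity) (fun u hu => le_of_lt hu) (z * q)
    rw [le_div_iff₀ (by positivity)]
    refine le_of_mul_le_mul_right ?_ (show (0 : ℝ) < ‖g‖ ^ 2 / 4 by positivity)
    calc _ = ((F.filter fun t => (z * q)⁻¹ * t ∈ U).card : ℝ) * (‖g‖ ^ 2 / 2) ^ 2 := by ring
      _ ≤ B * ‖g‖ ^ 2 := h1
      _ = _ := by ring
  have hsub : F' ⊆ s.biUnion fun q => F.filter fun t => (z * q)⁻¹ * t ∈ U := by
    intro t ht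
    obtain ⟨q, hqs, hqU⟩ := hs _ (hz t ht)
    refine Finset.mem_biUnion.2 ⟨q, hqs, Finset.mem_filter.2 ⟨hF' ht, ?_⟩⟩
    simpa [mul_assoc] using hqU
  calc (F'.card : ℝ) ≤ ∑ q ∈ s, ((F.filter fun t => (z * q)⁻¹ * t ∈ U).card : ℝ) := by
        exact_mod_cast (Finset.card_le_card hsub).trans Finset.card_biUnion_le
    _ ≤ s.card • (4 * B / ‖g‖ ^ 2) := Finset.sum_le_card_nsmul _ _ _ hq
    _ = _ := nsmul_eq_mul _ _

end Density

/-! ### The trace of the projection -/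

section Trace

variable {G H : Type*} [Group G] [MeasurableSpace G] [NormedAddCommGroup H]
  [InnerProductSpace ℂ H] {π : ProjRep G H} {Λ : Set G} {g : H} {A B d : ℝ}

/-- The trace of the projection onto a finite part of a Riesz sequence, computed by the
orthogonality relations and split along `K`. -/
theorem IsRieszSeq.card_mul_le {μ : Measure G} (hd : IsFormalDegree μ π d)
    (h : IsRieszSeq π Λ g A B) {F : Finset G} (hF : (F : Set G) ⊆ Λ) {K : Set G}
    (hK : MeasurableSet K) :
    (F.card : ℝ≥0∞) * ‖g‖ₑ ^ 2 ≤ ENNReal.ofReal d * (‖g‖ₑ ^ 2 * μ K +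
      ENNReal.ofReal A⁻¹ * ∫⁻ y in Kᶜ, ∑ t ∈ F, ‖coeff π g g (y⁻¹ * t)‖ₑ ^ 2 ∂μ) := by
  have hA := h.1
  let v : F → H := fun t => π (t : G) g
  have hlow : ∀ a : F → ℂ, A * ∑ t, ‖a t‖ ^ 2 ≤ ‖∑ t, a t • v t‖ ^ 2 := fun a =>
    (h.finset_bounds hF a).1
  let V : Submodule ℂ H := Submodule.span ℂ (range v)
  have hfin : FiniteDimensional ℂ V := FiniteDimensional.span_of_finite ℂ (finite_range v)
  have hrank : Module.finrank ℂ V = F.card := by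
    rw [finrank_span_eq_card (linearIndependent_of_lower_bound hA hlow), Fintype.card_coe]
  let b := stdOrthonormalBasis ℂ V
  have hproj : ∀ y, ∑ i, ‖coeff π g (b i : H) y‖ ^ 2 =
      ‖V.orthogonalProjectionOnto (π y g)‖ ^ 2 := by
    intro y
    rw [← b.sum_sq_norm_inner_right]
    refine Finset.sum_congr rfl fun i _ => ?_
    rw [Submodule.inner_orthogonalProjectionOnto_eq_of_mem_left, coeff, norm_inner_symm]
  have hin : ∀ y, ∑ i, ‖coeff π g (b i : H) y‖ₑ ^ 2 ≤ ‖g‖ₑ ^ 2 := by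
    intro y
    have h1 : ∑ i, ‖coeff π g (b i : H) y‖ ^ 2 ≤ ‖g‖ ^ 2 := by
      rw [hproj]
      have := V.norm_orthogonalProjectionOnto_apply_le (π y g)
      rw [LinearIsometryEquiv.norm_map] at this
      gcongr
    have h2 := ENNReal.ofReal_le_ofReal h1
    rw [ENNReal.ofReal_sum_of_nonneg fun _ _ => by positivity] at h2
    simpa [ENNReal.ofReal_pow] using h2
  -- The projection of π(y)g lies in V and has the same inner products with the v_t as π(y)g itself,
  -- so the frame inequality on V applies.
  have hout : ∀ y, ∑ i, ‖coeff π g (b i : H) y‖ₑ ^ 2 ≤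
      ENNReal.ofReal A⁻¹ * ∑ t ∈ F, ‖coeff π g g (y⁻¹ * t)‖ₑ ^ 2 := by
    intro y
    have h1 : ∑ i, ‖coeff π g (b i : H) y‖ ^ 2 ≤
        A⁻¹ * ∑ t ∈ F, ‖coeff π g g (y⁻¹ * t)‖ ^ 2 := by
      rw [hproj, le_inv_mul_iff₀ hA]
      refine (mul_norm_sq_le_sum_norm_inner_sq hlow
        (V.orthogonalProjectionOnto (π y g)).2).trans_eq ?_
      rw [← Finset.sum_coe_sort F]
      refine Finset.sum_congr rfl fun t _ => ?_
      have hvt : v t ∈ V := Submodule.subset_span (mem_range_self t)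
      have h3 : inner ℂ (v t) (V.orthogonalProjectionOnto (π y g) : H) = inner ℂ (v t) (π y g) :=
        Submodule.inner_orthogonalProjectionOnto_eq_of_mem_left ⟨v t, hvt⟩ (π y g)
      rw [h3, norm_inner_symm, π.norm_inner_apply_apply, norm_inner_symm, coeff]
    have h2 := ENNReal.ofReal_le_ofReal h1
    rw [ENNReal.ofReal_sum_of_nonneg fun _ _ => by positivity,
      ENNReal.ofReal_mul (by positivity),
      ENNReal.ofReal_sum_of_nonneg fun _ _ => by positivity] at h2
    simpa [ENNReal.ofReal_pow] using h2
  have hmeas : ∀ i, Measurable fun y => ‖coeff π g (b i : H) y‖ₑ ^ 2 := fun i =>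
    (stronglyMeasurable_coeff π g _).enorm.pow_const 2
  have htr : (F.card : ℝ≥0∞) * ‖g‖ₑ ^ 2 =
      ENNReal.ofReal d * ∫⁻ y, ∑ i, ‖coeff π g (b i : H) y‖ₑ ^ 2 ∂μ := by
    rw [lintegral_finsetSum _ fun i _ => hmeas i, Finset.mul_sum]
    have hb : ∀ i, ‖(b i : H)‖ₑ = 1 := fun i => by
      rw [← ofReal_norm]
      have : ‖(b i : H)‖ = 1 := b.orthonormal.1 i
      simp [this]
    simp only [hd.lintegral_enorm_coeff_sq, hb]
    simp [hrank]
  rw [htr, ← lintegral_add_compl _ hK]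
  gcongr
  · calc _ ≤ ∫⁻ _ in K, ‖g‖ₑ ^ 2 ∂μ := lintegral_mono hin
      _ = _ := setLIntegral_const K _
  · rw [← lintegral_const_mul' _ _ ENNReal.ofReal_ne_top]
    exact lintegral_mono hout

end Trace

/-! ### Sampling and translation invariance -/

section Sampling

variable {G : Type*} [Group G] [TopologicalSpace G] [IsTopologicalGroup G]
    [MeasurableSpace G] [BorelSpace G] (μ : Measure G) [μ.IsMulLeftInvariant]

/-- Sampling of a function on a relatively separated set is controlled by the integral of its local
maximal function. -/
theorem measure_mul_sum_enorm_sq_le {Q : Set G} (hQ : Q⁻¹ = Q) {Φ : G → ℂ}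
    (hΦ : Continuous fun x => ‖Φ x‖) {F : Finset G} {K : Set G} (hFK : (F : Set G) ⊆ K) {R : ℝ}
    (hR : ∀ z : G, ∀ F' ⊆ F, (∀ t ∈ F', z⁻¹ * t ∈ Q) → (F'.card : ℝ) ≤ R) (y : G) :
    μ (interior Q) * ∑ t ∈ F, ‖Φ (y⁻¹ * t)‖ₑ ^ 2 ≤
      ENNReal.ofReal R * ∫⁻ z in K * Q, localMax Q Φ (y⁻¹ * z) ^ 2 ∂μ := by
  classical
  -- For z in W t, symmetry of Q gives z⁻¹t ∈ Q, so the sample at t is bounded by the maximal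
  -- function at z; `hR` bounds the overlap of these sets by R.
  let W : G → Set G := fun t => t • interior Q
  have hW : ∀ t, MeasurableSet (W t) := fun t => (isOpen_interior.smul t).measurableSet
  let M : G → ℝ≥0∞ := fun z => localMax Q Φ (y⁻¹ * z) ^ 2
  have hM : Measurable M :=
    ((measurable_localMax Q hΦ).comp (measurable_const_mul y⁻¹)).pow_const 2
  have hWQ : ∀ t z, z ∈ W t → z⁻¹ * t ∈ Q := by
    rintro t _ ⟨q, hq, rfl⟩
    have : q⁻¹ ∈ Q := by rw [← hQ]; simpa using interior_subset hq
    simpa using this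
  have hMge : ∀ t z, z ∈ W t → ‖Φ (y⁻¹ * t)‖ₑ ^ 2 ≤ M z := by
    intro t z hz
    have := enorm_le_localMax Φ (y⁻¹ * z) (hWQ t z hz)
    rw [mul_assoc, mul_inv_cancel_left] at this
    exact pow_le_pow_left' this 2
  calc μ (interior Q) * ∑ t ∈ F, ‖Φ (y⁻¹ * t)‖ₑ ^ 2
      = ∑ t ∈ F, ∫⁻ _ in W t, ‖Φ (y⁻¹ * t)‖ₑ ^ 2 ∂μ := by
        rw [Finset.mul_sum]
        refine Finset.sum_congr rfl fun t _ => ?_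
        rw [setLIntegral_const, measure_smul, mul_comm]
    _ ≤ ∑ t ∈ F, ∫⁻ z in W t, M z ∂μ :=
        Finset.sum_le_sum fun t _ => setLIntegral_mono hM fun z hz => hMge t z hz
    _ = ∫⁻ z, ∑ t ∈ F, (W t).indicator M z ∂μ := by
        rw [lintegral_finsetSum _ fun t _ => hM.indicator (hW t)]
        exact Finset.sum_congr rfl fun t _ => (lintegral_indicator (hW t) M).symm
    _ ≤ ∫⁻ z, (⋃ t ∈ F, W t).indicator (fun z => ENNReal.ofReal R * M z) z ∂μ := by
        refine lintegral_mono fun z => ?_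
        by_cases hz : z ∈ ⋃ t ∈ F, W t
        · rw [indicator_of_mem hz]
          simp only [indicator_apply]
          rw [← Finset.sum_filter, Finset.sum_const, nsmul_eq_mul]
          gcongr
          rw [← ENNReal.ofReal_natCast]
          exact ENNReal.ofReal_le_ofReal (hR z _ (Finset.filter_subset _ _) fun t ht =>
            hWQ t z (Finset.mem_filter.1 ht).2)
        · rw [indicator_of_notMem hz]
          refine (Finset.sum_eq_zero fun t ht => indicator_of_notMem (fun hzt => hz ?_) M).le
          exact mem_biUnion ht hzt
    _ = ENNReal.ofReal R * ∫⁻ z in ⋃ t ∈ F, W t, M z ∂μ := by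
        rw [lintegral_indicator (Finset.measurableSet_biUnion F fun t _ => hW t),
          lintegral_const_mul _ hM]
    _ ≤ ENNReal.ofReal R * ∫⁻ z in K * Q, M z ∂μ := by
        gcongr
        refine iUnion₂_subset fun t ht => ?_
        rintro _ ⟨q, hq, rfl⟩
        exact mul_mem_mul (hFK ht) (interior_subset hq)

/-- The integrand depends only on y⁻¹z, so translating both variables by x changes nothing. -/
theorem rieszError_smul {H : Type*} [NormedAddCommGroup H] [InnerProductSpace ℂ H]
    (π : ProjRep G H) (g : H) (Q K : Set G) (x : G) :
    rieszError μ π g Q (x • K) = rieszError μ π g Q K := by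
  have hx := measurePreserving_mul_left μ x
  have he := measurableEmbedding_mulLeft x
  have hpre : ∀ S : Set G, (fun y => x * y) ⁻¹' (x • S) = S := fun S => by
    ext y; simp [mem_smul_set_iff_inv_smul_mem]
  rw [rieszError, rieszError, ← hx.setLIntegral_comp_preimage_emb he, ← smul_set_compl, hpre]
  refine lintegral_congr fun y => ?_
  rw [← hx.setLIntegral_comp_preimage_emb he, smul_mul_assoc, hpre]
  refine lintegral_congr fun z => ?_
  rw [mul_inv_rev, mul_assoc, inv_mul_cancel_left]

end Sampling

/-- The cardinality of a set is the supremum of the cardinalities of its finite subsets. -/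
theorem encard_le_of_forall_finset {α : Type*} {S : Set α} {r : ℝ≥0∞}
    (h : ∀ F : Finset α, (F : Set α) ⊆ S → (F.card : ℝ≥0∞) ≤ r) : (S.encard : ℝ≥0∞) ≤ r := by
  rcases S.finite_or_infinite with hS | hS
  · have := h hS.toFinset (by simp)
    rwa [hS.encard_eq_coe_toFinset_card]
  · have : r = ∞ := by
      refine ENNReal.eq_top_of_forall_nnreal_le fun q => ?_
      obtain ⟨n, hn⟩ := exists_nat_ge q
      obtain ⟨F, hF, hc⟩ := hS.exists_subset_card_eq n
      refine le_trans ?_ (h F hF)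
      rw [hc]
      exact_mod_cast hn
    rw [this]
    exact le_top

/-! ### The density bound -/

section Main

variable {G H : Type*} [Group G] [TopologicalSpace G] [IsTopologicalGroup G]
    [T2Space G] [LocallyCompactSpace G] [SecondCountableTopology G]
    [MeasurableSpace G] [BorelSpace G]
    (μ : Measure G) [μ.IsHaarMeasure]
    [NormedAddCommGroup H] [InnerProductSpace ℂ H]
    [TopologicalSpace.SeparableSpace H]

/-- The density bound for finite subsets of Riesz sequences. -/
theorem exists_card_le {π : ProjRep G H} {d : ℝ} (hd : IsFormalDegree μ π d) {Q : Set G}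
    (hQ : IsSymmUnitNhd Q) (g : H) (A B : ℝ) :
    ∃ C : ℝ, 0 < C ∧ ∀ Λ : Set G, IsRieszSeq π Λ g A B → ∀ K : Set G, IsCompact K →
      ∀ F : Finset G, (F : Set G) ⊆ Λ ∩ K →
        (F.card : ℝ≥0∞) ≤ ENNReal.ofReal d * (μ K + ENNReal.ofReal C * rieszError μ π g Q K) := by
  -- The zero vector belongs to no Riesz sequence, so here `F` is empty and any C works.
  by_cases hg : g = 0
  · refine ⟨1, one_pos, fun Λ hΛ K _ F hF => ?_⟩
    have h1 := linearIndependent_of_lower_bound hΛ.1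
      (fun a => (hΛ.finset_bounds (hF.trans inter_subset_left) a).1)
    have h2 : F = ∅ := by
      by_contra hne
      obtain ⟨t, ht⟩ := Finset.nonempty_iff_ne_empty.2 hne
      exact h1.ne_zero ⟨t, ht⟩ (by rw [hg, map_zero])
    simp [h2]
  obtain ⟨R, hR⟩ := exists_card_filter_le π hQ hg A B
  have hn : 0 < ‖g‖ := norm_pos_iff.2 hg
  have hm0 : μ (interior Q) ≠ 0 :=
    (isOpen_interior.measure_pos μ ⟨1, mem_interior_iff_mem_nhds.2 hQ.mem_nhds⟩).ne'
  have hmt : μ (interior Q) ≠ ∞ :=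
    ((measure_mono (interior_subset.trans subset_closure)).trans_lt
      hQ.relCompact.measure_lt_top).ne
  set m := (μ (interior Q)).toReal with hm
  have hmpos : 0 < m := ENNReal.toReal_pos hm0 hmt
  have hmeq : μ (interior Q) = ENNReal.ofReal m := (ENNReal.ofReal_toReal hmt).symm
  -- The factors come from the frame inequality, the sampling estimate and the division by ‖g‖². The
  -- maximum with 1 secures C > 0, since A and R have no known sign before Λ is given.
  refine ⟨max 1 (A⁻¹ * (m⁻¹ * R) * (‖g‖ ^ 2)⁻¹), by positivity, fun Λ hΛ K hK F hF => ?_⟩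
  have hFΛ := hF.trans inter_subset_left
  have hA := hΛ.1
  set J := rieszError μ π g Q K with hJ
  have hsum : ∫⁻ y in Kᶜ, ∑ t ∈ F, ‖coeff π g g (y⁻¹ * t)‖ₑ ^ 2 ∂μ ≤
      ENNReal.ofReal (m⁻¹ * R) * J := by
    rw [hJ, rieszError, ← lintegral_const_mul' _ _ ENNReal.ofReal_ne_top]
    refine lintegral_mono fun y => ?_
    have h1 := measure_mul_sum_enorm_sq_le μ hQ.symm (continuous_norm_coeff μ π g g)
      (hF.trans inter_subset_right) (hR Λ hΛ F hFΛ) y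
    rw [hmeq] at h1
    have h2 := mul_le_mul_right h1 (ENNReal.ofReal m⁻¹)
    rwa [← mul_assoc, ← mul_assoc, ← ENNReal.ofReal_mul (by positivity),
      ← ENNReal.ofReal_mul (by positivity), inv_mul_cancel₀ hmpos.ne', ENNReal.ofReal_one,
      one_mul] at h2
  have h1 := hΛ.card_mul_le hd hFΛ (μ := μ) hK.measurableSet
  have hgsq : ‖g‖ₑ ^ 2 = ENNReal.ofReal (‖g‖ ^ 2) := by
    rw [ENNReal.ofReal_pow hn.le, ofReal_norm]
  have hg2 : ENNReal.ofReal ((‖g‖ ^ 2)⁻¹) * ‖g‖ₑ ^ 2 = 1 := by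
    rw [hgsq, ← ENNReal.ofReal_mul (by positivity), inv_mul_cancel₀ (by positivity),
      ENNReal.ofReal_one]
  calc (F.card : ℝ≥0∞) = ENNReal.ofReal ((‖g‖ ^ 2)⁻¹) * (F.card * ‖g‖ₑ ^ 2) := by
        rw [mul_left_comm, hg2, mul_one]
    _ ≤ ENNReal.ofReal ((‖g‖ ^ 2)⁻¹) * (ENNReal.ofReal d * (‖g‖ₑ ^ 2 * μ K +
          ENNReal.ofReal A⁻¹ * (ENNReal.ofReal (m⁻¹ * R) * J))) := by
        refine mul_le_mul_right (h1.trans ?_) _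
        gcongr
    _ = ENNReal.ofReal d * ((ENNReal.ofReal ((‖g‖ ^ 2)⁻¹) * ‖g‖ₑ ^ 2) * μ K +
          (ENNReal.ofReal A⁻¹ * ENNReal.ofReal (m⁻¹ * R) * ENNReal.ofReal ((‖g‖ ^ 2)⁻¹)) * J) := by
        ring
    _ = ENNReal.ofReal d * (μ K +
          ENNReal.ofReal (A⁻¹ * (m⁻¹ * R) * (‖g‖ ^ 2)⁻¹) * J) := by
        rw [hg2, one_mul, ENNReal.ofReal_mul' (q := (‖g‖ ^ 2)⁻¹) (by positivity),
          ENNReal.ofReal_mul (p := A⁻¹) (by positivity)]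
    _ ≤ _ := by
        gcongr
        exact le_max_right _ _

end Main

end CoherentSystem

open CoherentSystem
theorem theorem3p4 {G H : Type*} [Group G] [TopologicalSpace G] [IsTopologicalGroup G]
    [T2Space G] [LocallyCompactSpace G] [SecondCountableTopology G]
    [MeasurableSpace G] [BorelSpace G]
    (μ : Measure G) [μ.IsHaarMeasure] [μ.IsMulRightInvariant]
    [NormedAddCommGroup H] [InnerProductSpace ℂ H] [CompleteSpace H]
    [TopologicalSpace.SeparableSpace H]
    (π : ProjRep G H) (hπ : IsDiscreteSeries μ π)
    (Q : Set G) (hQ : IsSymmUnitNhd Q)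
    (g : H) (hg : g ∈ localized μ π) (A B : ℝ) :
    ∃ C : ℝ, 0 < C ∧
      ∀ Λ : Set G, IsRieszSeq π Λ g A B →
      ∀ K : ℕ → Set G, IsStrongFolnerExhaustion μ K →
        (∀ n, rieszError μ π g Q (K n) < ∞ ∧
          (⨆ x : G, ((Λ ∩ x • K n).encard : ℝ≥0∞))
            ≤ ENNReal.ofReal (formalDegree μ π) *
              (μ (K n) + ENNReal.ofReal C * rieszError μ π g Q (K n))) ∧
        (fun n => (rieszError μ π g Q (K n)).toReal) =o[atTop]
          (fun n => (μ (K n)).toReal) := by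
  obtain ⟨C, hC, h⟩ := exists_card_le μ (hπ.isFormalDegree_formalDegree μ) hQ g A B
  refine ⟨C, hC, fun Λ hΛ K hK => ⟨fun n => ⟨rieszError_lt_top hQ hg (hK.isCompact n),
    iSup_le fun x => encard_le_of_forall_finset fun F hF => ?_⟩,
    rieszError_isLittleO hQ hg hK.toIsStrongFolner⟩⟩
  have h1 := h Λ hΛ (x • K n) ((hK.isCompact n).smul x) F hF
  rwa [measure_smul, rieszError_smul] at h1
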